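/- For each $n\ge 1$ let $G_n$ be an $n\times n$ random matrix with i.i.d. standard Gaussian entries. For $1\le r<\infty$ let $\|x\|_r=(\sum_i|x_i|^r)^{1/r}$, let $\|x\|_\infty=\max_i|x_i|$, and for $1\le p,q\le\infty$ let $\|A\|_{p\to q}=\sup_{\|x\|_p=1}\|Ax\|_q$. Let $p^*$ denote the Hölder conjugate of $p$, i.e. $1/p+1/p^*=1$ (with $1/\infty=0$). For $1\le r<\infty$ let $\xi_r=(\mathbb{E}|z|^r)^{1/r}$, where $z$ is a standard Gaussian variable, and for $1\le a,b\le\infty$ let $\mathfrak{p}(a,b)=(1/a-1/2)_++1/b$. Then $\|G_n\|_{p\to q}$ is integrable for all $1\le p,q\le\infty$ and all $n$, and the following limits hold. (i) For $p=1$ and $1\le q<\infty$, $$\lim_{n\to\infty}n^{-1/q}\,\mathbb{E}\|G_n\|_{p\to q}=\xi_q.$$ (ii) For $1<p\le\infty$ and $q=\infty$, $$\lim_{n\to\infty}n^{-1/p^*}\,\mathbb{E}\|G_n\|_{p\to q}=\xi_{p^*}.$$ (iii) For $1<p\le\infty$ and $1\le q<\infty$, if $\mathfrak{p}(q,p^*)\ne\mathfrak{p}(p^*,q)$,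 then $$\lim_{n\to\infty}n^{-\max(\mathfrak{p}(q,p^*),\,\mathfrak{p}(p^*,q))}\,\mathbb{E}\|G_n\|_{p\to q}=\begin{cases}\xi_{p^*},&\text{if }\mathfrak{p}(q,p^*)>\mathfrak{p}(p^*,q),\\ \xi_q,&\text{if }\mathfrak{p}(q,p^*)<\mathfrak{p}(p^*,q).\end{cases}$$ -/

import Mathlib

open MeasureTheory ProbabilityTheory Filter Topology
open scoped ENNReal Matrix

/-- The `p`-to-`q` operator norm `‖A‖_{p → q} = sup_{‖x‖_p = 1} ‖A x‖_q` of a real `n × n` matrix,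
for `1 ≤ p, q ≤ ∞`. The norm on `PiLp r` is the (unnormalized) `ℓ_r`-norm. -/
noncomputable def matrixOpNorm {n : ℕ} (p q : ℝ≥0∞) (A : Matrix (Fin n) (Fin n) ℝ) : ℝ :=
  ⨆ x : {x : PiLp p (fun _ : Fin n => ℝ) // ‖x‖ = 1}, ‖WithLp.toLp q (A *ᵥ WithLp.ofLp x.1)‖

/-- `ξ_r = (𝔼 |z|^r)^(1/r)` for a standard Gaussian variable `z`; used only for `1 ≤ r < ∞`. -/
noncomputable def gaussianXi (r : ℝ≥0∞) : ℝ :=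
  (∫ z : ℝ, |z| ^ r.toReal ∂gaussianReal 0 1) ^ (1 / r.toReal)

/-- The exponent `𝔭(a, b) = (1/a - 1/2)₊ + 1/b`, for `1 ≤ a, b ≤ ∞` and with `1/∞ = 0`. -/
noncomputable def chevetExponent (a b : ℝ≥0∞) : ℝ :=
  max ((a⁻¹).toReal - 1 / 2) 0 + (b⁻¹).toReal

/-- The random `n × n` matrix `G` has i.i.d. standard Gaussian entries under `P`. -/
structure IsStdGaussianMatrix {n : ℕ} {Ω : Type*} [MeasurableSpace Ω]
    (G : Ω → Matrix (Fin n) (Fin n) ℝ) (P : Measure Ω) : Prop where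
  /-- Each entry is a standard Gaussian random variable. -/
  hasLaw : ∀ i j, HasLaw (fun ω => G ω i j) (gaussianReal 0 1) P
  /-- All `n²` entries are jointly independent. -/
  indep : iIndepFun (fun (ij : Fin n × Fin n) ω => G ω ij.1 ij.2) P

/-! By duality, `‖G‖_{p→q}` is the supremum of `⟨y, Gx⟩` over the unit balls of `ℓ_p` and of the
dual of `ℓ_q`. The largest Euclidean lengths on these balls are `R = n^{(1/p* - 1/2)₊}` and `S =
n^{(1/q - 1/2)₊}`. Put `A = R E‖g‖_q` and `B = S E‖g‖_{p*}` for a standard Gaussian vector `g`. The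
limits follow from `A ≤ E‖G‖ ≤ A + B`, together with `B ≤ E‖G‖` when `p* < ∞`.

Lower bounds: for a fixed `x` of maximal Euclidean length, `Gx` has the law of `R g`; dually, `Gᵀy`
has the law of `S g`. Upper bound (Chevet): the increments of `⟨y, Gx⟩` are dominated by those of
`R⟨g, y⟩ + ‖y‖₂⟨h, x⟩`, so Sudakov–Fernique applies.

Concentration of `∑ |gᵢ|^r` gives `E‖g‖_r ~ ξ_r n^{1/r}` for `r < ∞`, while `E‖g‖_∞` grows slower
than every positive power of `n`. Hence `A` and `B` have growth exponents `𝔭(p*, q)` and `𝔭(q, p*)`,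
and when these differ the larger term gives the limit.

Sudakov–Fernique is proved by doubling. Replace the maximum by `logSumExp`. At scale `r` a Taylor
expansion compares the two Gaussian laws up to `O(r³)`, uniformly in the base point. Rotation
invariance turns a comparison at scale `r` with error `c` into one at scale `√2 r` with error `2c`.
Starting from `r = 2^{-m/2}`, `m` doublings reach scale one with error `O(2^{-m/2})`. -/

/-! ### Taylor expansion of cumulant generating functions -/

theorem Real.abs_log_one_add_sub_le {w : ℝ} (hw : |w| ≤ 1 / 2) :
    |Real.log (1 + w) - (w - w ^ 2 / 2)| ≤ 2 * |w| ^ 3 := by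
  have h := Real.abs_log_sub_add_sum_range_le (x := -w) (by rw [abs_neg]; linarith) 2
  simp only [Finset.sum_range_succ, Finset.sum_range_zero, abs_neg, sub_neg_eq_add] at h
  have h2 : |w| ^ (2 + 1) / (1 - |w|) ≤ 2 * |w| ^ 3 := by
    rw [div_le_iff₀ (by linarith)]
    have : 0 ≤ |w| ^ 3 := by positivity
    norm_num
    nlinarith
  refine le_trans (le_of_eq ?_) (h.trans h2)
  congr 1
  push_cast
  ring

theorem Real.abs_exp_sub_quadratic_le {u : ℝ} (hu : |u| ≤ 1) :
    |Real.exp u - (1 + u + u ^ 2 / 2)| ≤ |u| ^ 3 := by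
  have h := Real.exp_bound hu (n := 3) (by norm_num)
  have h0 : 0 ≤ |u| ^ 3 := by positivity
  simp only [Finset.sum_range_succ, Finset.sum_range_zero, Nat.factorial] at h
  norm_num at h
  refine h.trans ?_
  linarith

section Weighted
variable {ι : Type*} [Fintype ι] {p : ι → ℝ}

theorem abs_sum_weighted_le (hp : ∀ i, 0 ≤ p i) (hp1 : ∑ i, p i = 1) {f : ι → ℝ} {M : ℝ}
    (hf : ∀ i, |f i| ≤ M) : |∑ i, p i * f i| ≤ M := by
  calc |∑ i, p i * f i| ≤ ∑ i, |p i * f i| := Finset.abs_sum_le_sum_abs _ _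
    _ ≤ ∑ i, p i * M := Finset.sum_le_sum fun i _ => by
        rw [abs_mul, abs_of_nonneg (hp i)]; exact mul_le_mul_of_nonneg_left (hf i) (hp i)
    _ = M := by rw [← Finset.sum_mul, hp1, one_mul]

theorem abs_log_sum_weighted_exp_le (hp : ∀ i, 0 ≤ p i) (hp1 : ∑ i, p i = 1) {u : ι → ℝ} {M : ℝ}
    (hu : ∀ i, |u i| ≤ M) : |Real.log (∑ i, p i * Real.exp (u i))| ≤ M := by
  have lo : Real.exp (-M) ≤ ∑ i, p i * Real.exp (u i) := by
    calc Real.exp (-M) = ∑ i, p i * Real.exp (-M) := by rw [← Finset.sum_mul, hp1, one_mul]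
      _ ≤ _ := Finset.sum_le_sum fun i _ => mul_le_mul_of_nonneg_left
        (Real.exp_le_exp.2 (abs_le.1 (hu i)).1) (hp i)
  have hi : ∑ i, p i * Real.exp (u i) ≤ Real.exp M := by
    calc ∑ i, p i * Real.exp (u i) ≤ ∑ i, p i * Real.exp M :=
          Finset.sum_le_sum fun i _ => mul_le_mul_of_nonneg_left
            (Real.exp_le_exp.2 (abs_le.1 (hu i)).2) (hp i)
      _ = Real.exp M := by rw [← Finset.sum_mul, hp1, one_mul]
  have pos := (Real.exp_pos _).trans_le lo
  exact abs_le.2 ⟨(Real.le_log_iff_exp_le pos).2 lo, (Real.log_le_iff_le_exp pos).2 hi⟩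

/-- Second-order expansion of the cumulant generating function of a finitely supported law. -/
theorem abs_log_sum_weighted_exp_sub_le (hp : ∀ i, 0 ≤ p i) (hp1 : ∑ i, p i = 1) {u : ι → ℝ}
    {M : ℝ} (hM : 0 ≤ M) (hu : ∀ i, |u i| ≤ M) :
    |Real.log (∑ i, p i * Real.exp (u i)) - (∑ i, p i * u i +
      (∑ i, p i * u i ^ 2 - (∑ i, p i * u i) ^ 2) / 2)| ≤ 36 * M ^ 3 := by
  set m := ∑ i, p i * u i with hm
  set v := ∑ i, p i * u i ^ 2 with hv
  have hm' : |m| ≤ M := abs_sum_weighted_le hp hp1 hu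
  have hv' : |v| ≤ M ^ 2 := abs_sum_weighted_le hp hp1 fun i => by
    rw [abs_pow]; exact pow_le_pow_left₀ (abs_nonneg _) (hu i) 2
  have hM3 : 0 ≤ M ^ 3 := by positivity
  rcases le_or_gt M (1 / 4) with h4 | h4
  · set w := ∑ i, p i * Real.exp (u i) - 1 with hw
    have hr : |w - (m + v / 2)| ≤ M ^ 3 := by
      have : w - (m + v / 2) = ∑ i, p i * (Real.exp (u i) - (1 + u i + u i ^ 2 / 2)) := by
        rw [hw, hm, hv, Finset.sum_div]
        simp only [mul_sub, mul_add, Finset.sum_sub_distrib, Finset.sum_add_distrib, mul_one, hp1]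
        have : ∑ i, p i * (u i ^ 2 / 2) = ∑ i, p i * u i ^ 2 / 2 :=
          Finset.sum_congr rfl fun i _ => by ring
        rw [this]; ring
      rw [this]
      refine abs_sum_weighted_le hp hp1 fun i => ?_
      refine (Real.abs_exp_sub_quadratic_le ((hu i).trans (by linarith))).trans ?_
      exact pow_le_pow_left₀ (abs_nonneg _) (hu i) 3
    have hM32 : M ^ 3 ≤ M ^ 2 / 4 := by nlinarith [sq_nonneg M]
    have hM21 : M ^ 2 ≤ M / 4 := by nlinarith
    have hwm : |w - m| ≤ M ^ 2 := by
      have : w - m = (w - (m + v / 2)) + v / 2 := by ring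
      rw [this]
      refine (abs_add_le _ _).trans ?_
      rw [abs_div, abs_two]
      linarith
    have hw2 : |w| ≤ 2 * M := by
      have : w = (w - m) + m := by ring
      rw [this]
      refine (abs_add_le _ _).trans ?_
      linarith
    have hlog := Real.abs_log_one_add_sub_le (w := w) (by linarith)
    have hw3 : |w| ^ 3 ≤ 8 * M ^ 3 := by
      calc |w| ^ 3 ≤ (2 * M) ^ 3 := pow_le_pow_left₀ (abs_nonneg _) hw2 3
        _ = 8 * M ^ 3 := by ring
    have hsq : |w ^ 2 - m ^ 2| ≤ 3 * M ^ 3 := by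
      have : w ^ 2 - m ^ 2 = (w - m) * (w + m) := by ring
      rw [this, abs_mul]
      calc |w - m| * |w + m| ≤ M ^ 2 * (3 * M) := by
            refine mul_le_mul hwm ?_ (abs_nonneg _) (by positivity)
            exact (abs_add_le _ _).trans (by linarith)
        _ = 3 * M ^ 3 := by ring
    have e1 : ∑ i, p i * Real.exp (u i) = 1 + w := by rw [hw]; ring
    rw [e1]
    rw [abs_le] at *
    constructor <;> linarith [hlog.1, hlog.2, hsq.1, hsq.2, hr.1, hr.2]
  -- For `M > 1/4` no cancellation is needed: the four terms add up to at most `2M + M²`, and `M ≤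
  -- 16 M³`, `M² ≤ 4 M³`. This case dictates the constant 36.
  · have hlog := abs_log_sum_weighted_exp_le hp hp1 hu
    have hm2 : m ^ 2 ≤ M ^ 2 := by rw [← sq_abs]; exact pow_le_pow_left₀ (abs_nonneg _) hm' 2
    have hm20 := sq_nonneg m
    have a1 : M ^ 2 ≤ 4 * M ^ 3 := by nlinarith [sq_nonneg M]
    have a2 : M ≤ 4 * M ^ 2 := by nlinarith
    rw [abs_le] at *
    constructor <;> linarith [hlog.1, hlog.2, hm'.1, hm'.2, hv'.1, hv'.2]

/-- Variance through pairwise differences: this is what makes the comparison depend only on the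
increments `x i - x j`. -/
theorem sum_weighted_sq_sub_sq (hp1 : ∑ i, p i = 1) (x : ι → ℝ) :
    ∑ i, p i * x i ^ 2 - (∑ i, p i * x i) ^ 2 =
      (∑ i, ∑ j, p i * p j * (x i - x j) ^ 2) / 2 := by
  have h : ∑ i, ∑ j, p i * p j * (x i - x j) ^ 2 =
      (∑ i, p i * x i ^ 2) * (∑ j, p j) + (∑ i, p i) * (∑ j, p j * x j ^ 2)
        - 2 * ((∑ i, p i * x i) * ∑ j, p j * x j) := by
    rw [Finset.sum_mul_sum, Finset.sum_mul_sum, Finset.sum_mul_sum]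
    simp only [Finset.mul_sum, ← Finset.sum_add_distrib, ← Finset.sum_sub_distrib]
    exact Finset.sum_congr rfl fun i _ => Finset.sum_congr rfl fun j _ => by ring
  rw [h, hp1]; ring

end Weighted

/-! ### The smooth maximum -/

section LogSumExp
variable {ι : Type*} [Fintype ι]

/-- The smooth maximum `log ∑ exp zᵢ`. -/
noncomputable def logSumExp (z : ι → ℝ) : ℝ := Real.log (∑ i, Real.exp (z i))

variable [Nonempty ι]

theorem sum_exp_pos (z : ι → ℝ) : 0 < ∑ i, Real.exp (z i) :=
  Finset.sum_pos (fun _ _ => Real.exp_pos _) Finset.univ_nonempty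

theorem continuous_logSumExp : Continuous (logSumExp : (ι → ℝ) → ℝ) := by
  unfold logSumExp
  exact Continuous.log (by fun_prop) fun z => (sum_exp_pos z).ne'

theorem iSup_le_logSumExp (z : ι → ℝ) : ⨆ i, z i ≤ logSumExp z :=
  ciSup_le fun i => (Real.le_log_iff_exp_le (sum_exp_pos z)).2 <|
    Finset.single_le_sum (f := fun i => Real.exp (z i)) (fun _ _ => (Real.exp_pos _).le)
      (Finset.mem_univ i)

theorem logSumExp_le_iSup_add (z : ι → ℝ) :
    logSumExp z ≤ (⨆ i, z i) + Real.log (Fintype.card ι) := by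
  have hc : (0 : ℝ) < Fintype.card ι := by exact_mod_cast Fintype.card_pos
  rw [logSumExp, Real.log_le_iff_le_exp (sum_exp_pos z), Real.exp_add, Real.exp_log hc]
  calc ∑ i, Real.exp (z i) ≤ ∑ _i : ι, Real.exp (⨆ i, z i) :=
        Finset.sum_le_sum fun i _ => Real.exp_le_exp.2 (le_ciSup (Set.finite_range z).bddAbove i)
    _ = _ := by simp [mul_comm]

/-- The increment is a cumulant generating function of `u` under the softmax weights at `z`, so the
weighted estimates apply with constants independent of `z`. -/
theorem logSumExp_add (z u : ι → ℝ) : logSumExp (z + u) = logSumExp z +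
    Real.log (∑ i, Real.exp (z i) / (∑ j, Real.exp (z j)) * Real.exp (u i)) := by
  have h0 := sum_exp_pos z
  have : ∑ i, Real.exp (z i) / (∑ j, Real.exp (z j)) * Real.exp (u i) =
      (∑ i, Real.exp ((z + u) i)) / ∑ j, Real.exp (z j) := by
    rw [Finset.sum_div]
    exact Finset.sum_congr rfl fun i _ => by rw [Pi.add_apply, Real.exp_add]; ring
  rw [this, Real.log_div (sum_exp_pos _).ne' h0.ne', logSumExp, logSumExp]
  ring

theorem sum_softmax (z : ι → ℝ) : ∑ i, Real.exp (z i) / (∑ j, Real.exp (z j)) = 1 := by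
  rw [← Finset.sum_div, div_self (sum_exp_pos z).ne']

theorem abs_logSumExp_add_sub_le (z u : ι → ℝ) : |logSumExp (z + u) - logSumExp z| ≤ ‖u‖ := by
  rw [logSumExp_add, add_sub_cancel_left]
  exact abs_log_sum_weighted_exp_le (fun i => (div_pos (Real.exp_pos _) (sum_exp_pos z)).le)
    (sum_softmax z) fun i => norm_le_pi_norm u i

end LogSumExp

/-! ### Sudakov–Fernique by doubling -/

section Comparison
variable {ι : Type*} [Fintype ι] {μ ν : Measure (ι → ℝ)} [IsGaussian μ] [IsGaussian ν]

theorem integrable_norm_pow_of_isGaussian (k : ℕ) : Integrable (fun x : ι → ℝ => ‖x‖ ^ k) μ := by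
  simpa using (IsGaussian.memLp_id μ k (by simp)).integrable_norm_pow'

theorem memLp_two_eval (i : ι) : MemLp (fun x : ι → ℝ => x i) 2 μ :=
  IsGaussian.memLp_dual μ (ContinuousLinearMap.proj i) 2 (by simp)

theorem integral_eval_eq_zero (hμ : μ[id] = 0) (i : ι) : ∫ x, x i ∂μ = 0 := by
  have := IsGaussian.integral_dual (μ := μ) (ContinuousLinearMap.proj (R := ℝ) i)
  simp only [id] at hμ
  rw [hμ] at this
  simpa using this

variable [Nonempty ι]

theorem integrable_logSumExp_add {Ω : Type*} [MeasurableSpace Ω] {P : Measure Ω}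
    [IsFiniteMeasure P] {X : Ω → ι → ℝ} (hX : Integrable X P) (z : ι → ℝ) :
    Integrable (fun ω => logSumExp (z + X ω)) P := by
  refine Integrable.mono' ((integrable_const |logSumExp z|).add hX.norm) ?_ ?_
  · exact (continuous_logSumExp.comp (continuous_const_add z)).comp_aestronglyMeasurable hX.1
  · refine .of_forall fun ω => ?_
    rw [Real.norm_eq_abs, show logSumExp (z + X ω) =
      logSumExp z + (logSumExp (z + X ω) - logSumExp z) by ring]
    exact (abs_add_le _ _).trans (add_le_add_right (abs_logSumExp_add_sub_le z _) _)

/-- Expansion of the Gaussian smoothing of `logSumExp` at small scale `r`. -/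
theorem abs_integral_logSumExp_sub_le (hμ : μ[id] = 0) (z : ι → ℝ) {r : ℝ} (hr : 0 ≤ r) :
    |∫ x, logSumExp (z + r • x) ∂μ - (logSumExp z + r ^ 2 / 4 *
      ∑ i, ∑ j, Real.exp (z i) / (∑ k, Real.exp (z k)) * (Real.exp (z j) / (∑ k, Real.exp (z k))) *
        ∫ x, (x i - x j) ^ 2 ∂μ)| ≤ r ^ 3 * (36 * ∫ x, ‖x‖ ^ 3 ∂μ) := by
  set p : ι → ℝ := fun i => Real.exp (z i) / (∑ k, Real.exp (z k)) with hp
  have hp0 : ∀ i, 0 ≤ p i := fun i => (div_pos (Real.exp_pos _) (sum_exp_pos z)).le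
  have hp1 : ∑ i, p i = 1 := sum_softmax z
  -- The second-order Taylor polynomial. Its linear term integrates to zero by centering; the factor
  -- 1/4 is the 1/2 of the expansion times the 1/2 of the pairwise form of the variance.
  set T : (ι → ℝ) → ℝ := fun x => logSumExp z + (r * ∑ i, p i * x i +
    r ^ 2 / 4 * ∑ i, ∑ j, p i * p j * (x i - x j) ^ 2) with hT
  have hsq : ∀ i j, Integrable (fun x : ι → ℝ => (x i - x j) ^ 2) μ := fun i j =>
    ((memLp_two_eval i).sub (memLp_two_eval j)).integrable_sq
  have hev : ∀ i, Integrable (fun x : ι → ℝ => x i) μ := fun i =>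
    (memLp_two_eval i).integrable (by norm_num)
  have i1 : Integrable (fun x : ι → ℝ => r * ∑ i, p i * x i) μ :=
    (integrable_finsetSum _ fun i _ => (hev i).const_mul _).const_mul _
  have i2 : Integrable (fun x : ι → ℝ => r ^ 2 / 4 * ∑ i, ∑ j, p i * p j * (x i - x j) ^ 2) μ :=
    (integrable_finsetSum _ fun i _ => integrable_finsetSum _ fun j _ =>
      (hsq i j).const_mul _).const_mul _
  have i12 : Integrable (fun x : ι → ℝ => r * ∑ i, p i * x i +
    r ^ 2 / 4 * ∑ i, ∑ j, p i * p j * (x i - x j) ^ 2) μ := i1.add i2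
  have hTi : Integrable T μ := (integrable_const _).add i12
  have hTint : ∫ x, T x ∂μ = logSumExp z + r ^ 2 / 4 *
      ∑ i, ∑ j, p i * p j * ∫ x, (x i - x j) ^ 2 ∂μ := by
    rw [hT, integral_add (integrable_const _) i12, integral_add i1 i2,
      integral_const_mul, integral_const_mul, integral_finsetSum _ fun i _ => (hev i).const_mul _,
      integral_finsetSum _ fun i _ => integrable_finsetSum _ fun j _ => (hsq i j).const_mul _]
    simp only [integral_const_mul, integral_eval_eq_zero hμ]
    have : ∀ i, ∫ x, ∑ j, p i * p j * (x i - x j) ^ 2 ∂μ =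
        ∑ j, p i * p j * ∫ x, (x i - x j) ^ 2 ∂μ := fun i => by
      rw [integral_finsetSum _ fun j _ => (hsq i j).const_mul _]
      simp only [integral_const_mul]
    simp [this]
  have hLi : Integrable (fun x => logSumExp (z + r • x)) μ :=
    integrable_logSumExp_add (IsGaussian.integrable_id.smul r) z
  rw [← hTint, ← integral_sub hLi hTi, ← integral_const_mul, ← integral_const_mul]
  refine (abs_integral_le_integral_abs).trans
    (integral_mono (hLi.sub hTi).abs
      (((integrable_norm_pow_of_isGaussian 3).const_mul _).const_mul _) fun x => ?_)
  have hu : ∀ i, |(r • x) i| ≤ r * ‖x‖ := fun i => by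
    rw [Pi.smul_apply, smul_eq_mul, abs_mul, abs_of_nonneg hr]
    exact mul_le_mul_of_nonneg_left (norm_le_pi_norm x i) hr
  have h := abs_log_sum_weighted_exp_sub_le hp0 hp1 (by positivity) hu
  have e : logSumExp (z + r • x) - T x = Real.log (∑ i, p i * Real.exp ((r • x) i)) -
      (∑ i, p i * (r • x) i + (∑ i, p i * (r • x) i ^ 2 - (∑ i, p i * (r • x) i) ^ 2) / 2) := by
    rw [logSumExp_add, sum_weighted_sq_sub_sq hp1, hT]
    have e1 : ∑ i, p i * (r • x) i = r * ∑ i, p i * x i := by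
      rw [Finset.mul_sum]
      exact Finset.sum_congr rfl fun i _ => by simp; ring
    have e2 : ∑ i, ∑ j, p i * p j * ((r • x) i - (r • x) j) ^ 2 =
        r ^ 2 * ∑ i, ∑ j, p i * p j * (x i - x j) ^ 2 := by
      simp only [Finset.mul_sum]
      exact Finset.sum_congr rfl fun i _ => Finset.sum_congr rfl fun j _ => by simp; ring
    rw [e1, e2]
    ring
  simp only [e]
  refine h.trans (le_of_eq (by ring))

/-- Rotation by `π/4` preserves `μ ⊗ μ`, so `√2 x` has the law of the sum of two independent copies
of `x`. -/
theorem integral_logSumExp_sqrt_two_smul (hμ : μ[id] = 0) (z : ι → ℝ) (r : ℝ) :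
    ∫ x, logSumExp (z + (√2 * r) • x) ∂μ =
      ∫ x, ∫ y, logSumExp (z + r • x + r • y) ∂μ ∂μ := by
  have hrot := IsGaussian.map_rotation_eq_self hμ (Real.pi / 4)
  have hfi : Integrable (fun w : (ι → ℝ) × (ι → ℝ) => logSumExp (z + (r • w.1 + r • w.2)))
      (μ.prod μ) := by
    refine integrable_logSumExp_add ?_ z
    exact (IsGaussian.integrable_id.comp_fst μ |>.smul r).add
      (IsGaussian.integrable_id.comp_snd μ |>.smul r)
  calc ∫ x, logSumExp (z + (√2 * r) • x) ∂μ
      = ∫ w : (ι → ℝ) × (ι → ℝ), logSumExp (z + (√2 * r) • w.1) ∂(μ.prod μ) := by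
        rw [integral_fun_fst (f := fun x => logSumExp (z + (√2 * r) • x))]
        simp
    _ = ∫ w, logSumExp (z + (√2 * r) • w.1)
          ∂((μ.prod μ).map (ContinuousLinearMap.rotation (Real.pi / 4))) := by rw [hrot]
    _ = ∫ w : (ι → ℝ) × (ι → ℝ), logSumExp (z + (r • w.1 + r • w.2)) ∂(μ.prod μ) := by
        rw [integral_map (by fun_prop) (by
          have := continuous_logSumExp (ι := ι)
          exact Continuous.aestronglyMeasurable (by fun_prop))]
        congr 1; ext w
        congr 2
        have h2 : √2 * (√2 / 2) = (1 : ℝ) := by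
          rw [← mul_div_assoc, Real.mul_self_sqrt (by norm_num)]; norm_num
        simp only [ContinuousLinearMap.rotation_apply, Real.cos_pi_div_four, Real.sin_pi_div_four]
        rw [← smul_add, smul_smul, ← smul_add,
          show √2 * r * (√2 / 2) = √2 * (√2 / 2) * r by ring, h2, one_mul]
    _ = _ := by
        rw [integral_prod _ hfi]
        simp only [add_assoc]

theorem integral_integral_logSumExp_swap (z : ι → ℝ) (r : ℝ) :
    ∫ x, ∫ y, logSumExp (z + r • x + r • y) ∂ν ∂μ =
      ∫ y, ∫ x, logSumExp (z + r • y + r • x) ∂μ ∂ν := by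
  rw [integral_integral_swap]
  · congr 1; ext y; congr 1; ext x
    rw [add_right_comm]
  · have : Integrable (fun w : (ι → ℝ) × (ι → ℝ) => logSumExp (z + (r • w.1 + r • w.2)))
      (μ.prod ν) := by
      refine integrable_logSumExp_add ?_ z
      exact (IsGaussian.integrable_id.comp_fst ν |>.smul r).add
        (IsGaussian.integrable_id.comp_snd μ |>.smul r)
    simpa only [Function.uncurry_def, add_assoc] using this

theorem integrable_integral_logSumExp (z : ι → ℝ) (r : ℝ) :
    Integrable (fun x => ∫ y, logSumExp (z + r • x + r • y) ∂ν) μ := by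
  have : Integrable (fun w : (ι → ℝ) × (ι → ℝ) => logSumExp (z + (r • w.1 + r • w.2)))
      (μ.prod ν) := by
    refine integrable_logSumExp_add ?_ z
    exact (IsGaussian.integrable_id.comp_fst ν |>.smul r).add
      (IsGaussian.integrable_id.comp_snd μ |>.smul r)
  simpa only [add_assoc] using this.integral_prod_left

/-- At scale `√2 r` there are two independent copies at scale `r`. They are exchanged one at a time,
each at cost `c`; uniformity of the hypothesis in `z` lets the other copy be absorbed into the base
point. -/
theorem integral_logSumExp_doubling (hμ : μ[id] = 0) (hν : ν[id] = 0) {r c : ℝ}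
    (h : ∀ z : ι → ℝ, ∫ x, logSumExp (z + r • x) ∂μ ≤ ∫ x, logSumExp (z + r • x) ∂ν + c)
    (z : ι → ℝ) :
    ∫ x, logSumExp (z + (√2 * r) • x) ∂μ ≤ ∫ x, logSumExp (z + (√2 * r) • x) ∂ν + 2 * c := by
  rw [integral_logSumExp_sqrt_two_smul hμ, integral_logSumExp_sqrt_two_smul hν]
  have key : ∀ (ρ : Measure (ι → ℝ)) [IsGaussian ρ],
      ∫ x, ∫ y, logSumExp (z + r • x + r • y) ∂μ ∂ρ ≤
        ∫ x, ∫ y, logSumExp (z + r • x + r • y) ∂ν ∂ρ + c := fun ρ _ => by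
    calc _ ≤ ∫ x, (∫ y, logSumExp (z + r • x + r • y) ∂ν + c) ∂ρ :=
          integral_mono (integrable_integral_logSumExp z r)
            ((integrable_integral_logSumExp z r).add (integrable_const c)) fun x => h _
      _ = _ := by
          rw [integral_add (integrable_integral_logSumExp z r) (integrable_const c)]
          simp
  have h1 := key μ
  have h2 := key ν
  rw [integral_integral_logSumExp_swap (μ := μ) (ν := ν)] at h1
  linarith

theorem integral_logSumExp_le (hμ : μ[id] = 0) (hν : ν[id] = 0)
    (h : ∀ i j, ∫ x, (x i - x j) ^ 2 ∂μ ≤ ∫ x, (x i - x j) ^ 2 ∂ν) :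
    ∫ x, logSumExp x ∂μ ≤ ∫ x, logSumExp x ∂ν := by
  set K := 36 * ∫ x, ‖x‖ ^ 3 ∂μ + 36 * ∫ x, ‖x‖ ^ 3 ∂ν with hK
  have small : ∀ r : ℝ, 0 ≤ r → ∀ z : ι → ℝ,
      ∫ x, logSumExp (z + r • x) ∂μ ≤ ∫ x, logSumExp (z + r • x) ∂ν + r ^ 3 * K := by
    intro r hr z
    have h1 := abs_le.1 (abs_integral_logSumExp_sub_le (μ := μ) hμ z hr)
    have h2 := abs_le.1 (abs_integral_logSumExp_sub_le (μ := ν) hν z hr)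
    have h3 : r ^ 2 / 4 * ∑ i, ∑ j, Real.exp (z i) / (∑ k, Real.exp (z k)) *
        (Real.exp (z j) / (∑ k, Real.exp (z k))) * ∫ x, (x i - x j) ^ 2 ∂μ ≤
        r ^ 2 / 4 * ∑ i, ∑ j, Real.exp (z i) / (∑ k, Real.exp (z k)) *
        (Real.exp (z j) / (∑ k, Real.exp (z k))) * ∫ x, (x i - x j) ^ 2 ∂ν := by
      refine mul_le_mul_of_nonneg_left (Finset.sum_le_sum fun i _ => Finset.sum_le_sum fun j _ =>
        mul_le_mul_of_nonneg_left (h i j) ?_) (by positivity)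
      have := sum_exp_pos z
      positivity
    rw [hK, mul_add]
    linarith [h1.2, h2.1]
  have iter : ∀ (m : ℕ) (r : ℝ), 0 ≤ r → ∀ z : ι → ℝ,
      ∫ x, logSumExp (z + (√2 ^ m * r) • x) ∂μ ≤
        ∫ x, logSumExp (z + (√2 ^ m * r) • x) ∂ν + 2 ^ m * (r ^ 3 * K) := by
    intro m r hr
    induction m with
    | zero => simpa using small r hr
    | succ m ih =>
      intro z
      have := integral_logSumExp_doubling hμ hν ih z
      rw [pow_succ' (√2), mul_assoc, pow_succ' (2 : ℝ), mul_assoc]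
      exact this
  -- With `r = (√2)⁻¹ ^ m` the scale after `m` doublings is one, and the error is `2^m r³ K = (√2)⁻¹
  -- ^ m K`.
  have final : ∀ m : ℕ, ∫ x, logSumExp x ∂μ ≤ ∫ x, logSumExp x ∂ν + (√2)⁻¹ ^ m * K := by
    intro m
    have h2 : (√2 : ℝ) ≠ 0 := by positivity
    have := iter m ((√2)⁻¹ ^ m) (by positivity) 0
    rw [← mul_pow, mul_inv_cancel₀ h2] at this
    simp only [one_pow, one_smul, zero_add] at this
    refine this.trans (le_of_eq ?_)
    have e : (2 : ℝ) ^ m = √2 ^ m * √2 ^ m := by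
      rw [← mul_pow, Real.mul_self_sqrt (by norm_num)]
    have e' : √2 ^ m * (√2)⁻¹ ^ m = 1 := by rw [← mul_pow, mul_inv_cancel₀ h2, one_pow]
    congr 1
    calc 2 ^ m * (((√2)⁻¹ ^ m) ^ 3 * K)
        = (√2 ^ m * (√2)⁻¹ ^ m) * (√2 ^ m * (√2)⁻¹ ^ m) * ((√2)⁻¹ ^ m * K) := by rw [e]; ring
      _ = _ := by rw [e']; ring
  have lim : Tendsto (fun m : ℕ => ∫ x, logSumExp x ∂ν + (√2)⁻¹ ^ m * K) atTop
      (𝓝 (∫ x, logSumExp x ∂ν + 0 * K)) := by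
    refine Tendsto.const_add _ (Tendsto.mul_const _ (tendsto_pow_atTop_nhds_zero_of_lt_one
      (by positivity) ?_))
    refine inv_lt_one_of_one_lt₀ ?_
    rw [Real.lt_sqrt (by norm_num)]; norm_num
  simpa using ge_of_tendsto' lim final

theorem continuous_iSup_pi : Continuous fun x : ι → ℝ => ⨆ i, x i := by
  have : (fun x : ι → ℝ => ⨆ i, x i) =
      fun x => Finset.univ.sup' Finset.univ_nonempty fun i => x i := by
    ext x; rw [Finset.sup'_univ_eq_ciSup]
  rw [this]
  exact Continuous.finset_sup'_apply _ fun i _ => continuous_apply i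

theorem abs_iSup_le_norm (x : ι → ℝ) : |⨆ i, x i| ≤ ‖x‖ := by
  obtain ⟨i, hi⟩ := exists_eq_ciSup_of_finite (f := x)
  rw [← hi]
  exact norm_le_pi_norm x i

theorem integrable_iSup_of_isGaussian : Integrable (fun x : ι → ℝ => ⨆ i, x i) μ :=
  Integrable.mono' IsGaussian.integrable_id.norm continuous_iSup_pi.aestronglyMeasurable
    (.of_forall abs_iSup_le_norm)

/-- The **Sudakov–Fernique inequality** for centered Gaussian measures. -/
theorem sudakov_fernique (hμ : μ[id] = 0) (hν : ν[id] = 0)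
    (h : ∀ i j, ∫ x, (x i - x j) ^ 2 ∂μ ≤ ∫ x, (x i - x j) ^ 2 ∂ν) :
    ∫ x, ⨆ i, x i ∂μ ≤ ∫ x, ⨆ i, x i ∂ν := by
  -- Dilating both laws by `β` and dividing by `β` reduces the smoothing error to `log |ι| / β`,
  -- which vanishes as `β → ∞`.
  have scale : ∀ β : ℝ, 0 < β → ∫ x, ⨆ i, x i ∂μ ≤
      ∫ x, ⨆ i, x i ∂ν + β⁻¹ * Real.log (Fintype.card ι) := by
    intro β hβ
    let S : (ι → ℝ) →L[ℝ] (ι → ℝ) := β • ContinuousLinearMap.id ℝ (ι → ℝ)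
    have hS : ∀ x, S x = β • x := fun x => rfl
    have map_int : ∀ (ρ : Measure (ι → ℝ)) [IsGaussian ρ] (f : (ι → ℝ) → ℝ), Continuous f →
        ∫ x, f x ∂(ρ.map S) = ∫ x, f (β • x) ∂ρ := fun ρ _ f hf => by
      rw [integral_map (by fun_prop) hf.aestronglyMeasurable]; rfl
    have center : ∀ (ρ : Measure (ι → ℝ)) [IsGaussian ρ], ρ[id] = 0 → (ρ.map S)[id] = 0 :=
      fun ρ _ hρ => by
        rw [integral_map (by fun_prop) (by fun_prop)]
        simp only [id] at hρ ⊢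
        rw [S.integral_comp_comm (φ := fun x => x) IsGaussian.integrable_id, hρ, map_zero]
    have main := integral_logSumExp_le (center μ hμ) (center ν hν) fun i j => by
      rw [map_int μ _ (by fun_prop), map_int ν _ (by fun_prop)]
      simp only [Pi.smul_apply, smul_eq_mul, ← mul_sub, mul_pow, integral_const_mul]
      exact mul_le_mul_of_nonneg_left (h i j) (by positivity)
    rw [map_int μ _ continuous_logSumExp, map_int ν _ continuous_logSumExp] at main
    have hLi : ∀ (ρ : Measure (ι → ℝ)) [IsGaussian ρ],
        Integrable (fun x => logSumExp (β • x)) ρ := fun ρ _ => by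
      simpa using integrable_logSumExp_add (IsGaussian.integrable_id.smul β) (0 : ι → ℝ)
    have hmul : ∀ x : ι → ℝ, ⨆ i, (β • x) i = β * ⨆ i, x i := fun x => by
      simp only [Pi.smul_apply, smul_eq_mul]
      rw [Real.mul_iSup_of_nonneg hβ.le]
    have lo : β * ∫ x, ⨆ i, x i ∂μ ≤ ∫ x, logSumExp (β • x) ∂μ := by
      rw [← integral_const_mul]
      refine integral_mono (integrable_iSup_of_isGaussian.const_mul β) (hLi μ) fun x => ?_
      simp only [← hmul]
      exact iSup_le_logSumExp _
    have hi : ∫ x, logSumExp (β • x) ∂ν ≤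
        β * ∫ x, ⨆ i, x i ∂ν + Real.log (Fintype.card ι) := by
      calc _ ≤ ∫ x, (β * (⨆ i, x i) + Real.log (Fintype.card ι)) ∂ν := by
            refine integral_mono (hLi ν)
              ((integrable_iSup_of_isGaussian.const_mul β).add (integrable_const _)) fun x => ?_
            simp only [← hmul]
            exact logSumExp_le_iSup_add _
        _ = _ := by
            rw [integral_add (integrable_iSup_of_isGaussian.const_mul β) (integrable_const _),
              integral_const_mul]
            simp
    have := lo.trans (main.trans hi)
    rw [← mul_le_mul_iff_right₀ hβ, mul_add, ← mul_assoc, mul_inv_cancel₀ hβ.ne', one_mul]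
    exact this
  have lim : Tendsto (fun β : ℝ => ∫ x, ⨆ i, x i ∂ν + β⁻¹ * Real.log (Fintype.card ι)) atTop
      (𝓝 (∫ x, ⨆ i, x i ∂ν + 0 * Real.log (Fintype.card ι))) :=
    (tendsto_inv_atTop_zero.mul_const _).const_add _
  have := ge_of_tendsto lim (eventually_gt_atTop 0 |>.mono scale)
  simpa using this

end Comparison

/-! ### Finite-dimensional `ℓ_r` norms and duality -/

section PiLpNorms
variable {ι : Type*} [Fintype ι]

/-- Gives access to Hölder's inequality and to the comparison of `L^r` norms on a finite measure
space, here of total mass `|ι|`, with infinite exponents included. -/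
theorem enorm_toLp_eq_eLpNorm_count [MeasurableSpace ι] [MeasurableSingletonClass ι] {r : ℝ≥0∞}
    [Fact (1 ≤ r)] (x : ι → ℝ) : ‖WithLp.toLp r x‖ₑ = eLpNorm x r Measure.count := by
  have h1 : (1 : ℝ≥0∞) ≤ r := Fact.out
  have hr0 : r ≠ 0 := (zero_lt_one.trans_le h1).ne'
  rw [← ofReal_norm]
  by_cases hr : r = ∞
  · subst hr
    rw [eLpNorm_exponent_top, eLpNormEssSup_count, PiLp.norm_toLp, ofReal_norm, enorm_eq_nnnorm,
      Pi.nnnorm_def, ENNReal.coe_finset_sup, Finset.sup_univ_eq_iSup]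
    rfl
  · have hpos : 0 < r.toReal := ENNReal.toReal_pos hr0 hr
    rw [eLpNorm_eq_lintegral_rpow_enorm_toReal hr0 hr, lintegral_count, tsum_fintype,
      PiLp.norm_eq_sum hpos, ← ENNReal.ofReal_rpow_of_nonneg
        (Finset.sum_nonneg fun i _ => by positivity) (by positivity),
      ENNReal.ofReal_sum_of_nonneg fun i _ => by positivity]
    congr 1
    refine Finset.sum_congr rfl fun i _ => ?_
    rw [← ENNReal.ofReal_rpow_of_nonneg (norm_nonneg _) hpos.le, ofReal_norm]

theorem norm_toLp_eq_sum_rpow {r : ℝ≥0∞} (h1 : 1 ≤ r) (hr : r ≠ ∞) (x : ι → ℝ) :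
    ‖WithLp.toLp r x‖ = (∑ i, |x i| ^ r.toReal) ^ (1 / r.toReal) := by
  rw [PiLp.norm_eq_sum (ENNReal.toReal_pos (zero_lt_one.trans_le h1).ne' hr)]
  rfl

theorem norm_toLp_le_of_le {r s : ℝ≥0∞} [hr1 : Fact (1 ≤ r)] [hs1 : Fact (1 ≤ s)] (hsr : s ≤ r)
    (x : ι → ℝ) : ‖WithLp.toLp r x‖ ≤ ‖WithLp.toLp s x‖ := by
  have hap : ∀ i, |x i| ≤ ‖WithLp.toLp s x‖ := fun i => PiLp.norm_apply_le (WithLp.toLp s x) i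
  by_cases hr : r = ∞
  · subst hr
    rw [PiLp.norm_toLp]
    exact (pi_norm_le_iff_of_nonneg (norm_nonneg _)).2 hap
  have hs : s ≠ ∞ := ne_top_of_le_ne_top hr hsr
  have hr0 : 0 < r.toReal := ENNReal.toReal_pos (zero_lt_one.trans_le hr1.out).ne' hr
  have hs0 : 0 < s.toReal := ENNReal.toReal_pos (zero_lt_one.trans_le hs1.out).ne' hs
  have hsr' : s.toReal ≤ r.toReal := ENNReal.toReal_mono hr hsr
  have hNs : ‖WithLp.toLp s x‖ ^ s.toReal = ∑ i, |x i| ^ s.toReal := by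
    rw [norm_toLp_eq_sum_rpow hs1.out hs, ← Real.rpow_mul (Finset.sum_nonneg fun i _ => by positivity),
      one_div_mul_cancel hs0.ne', Real.rpow_one]
  set N := ‖WithLp.toLp s x‖ with hN
  have hN0 : 0 ≤ N := norm_nonneg _
  rw [norm_toLp_eq_sum_rpow hr1.out hr]
  have key : ∑ i, |x i| ^ r.toReal ≤ N ^ r.toReal := by
    calc ∑ i, |x i| ^ r.toReal
        ≤ ∑ i, |x i| ^ s.toReal * N ^ (r.toReal - s.toReal) := Finset.sum_le_sum fun i _ => by
          rw [show r.toReal = s.toReal + (r.toReal - s.toReal) by ring,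
            Real.rpow_add_of_nonneg (abs_nonneg _) hs0.le (by linarith), add_sub_cancel_left]
          exact mul_le_mul_of_nonneg_left (Real.rpow_le_rpow (abs_nonneg _) (hap i) (by linarith))
            (by positivity)
      _ = N ^ r.toReal := by
          rw [← Finset.sum_mul, ← hNs, ← Real.rpow_add_of_nonneg hN0 hs0.le (by linarith)]
          congr 1; ring
  calc _ ≤ (N ^ r.toReal) ^ (1 / r.toReal) :=
        Real.rpow_le_rpow (Finset.sum_nonneg fun i _ => by positivity) key (by positivity)
    _ = N := by rw [← Real.rpow_mul hN0, mul_one_div_cancel hr0.ne', Real.rpow_one]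

theorem norm_toLp_le_card_rpow_mul {r s : ℝ≥0∞} [hr1 : Fact (1 ≤ r)] [hs1 : Fact (1 ≤ s)]
    [Nonempty ι] (x : ι → ℝ) : ‖WithLp.toLp r x‖ ≤
      (Fintype.card ι : ℝ) ^ max ((r⁻¹).toReal - (s⁻¹).toReal) 0 * ‖WithLp.toLp s x‖ := by
  have hr0 : r ≠ 0 := (zero_lt_one.trans_le hr1.out).ne'
  have hs0 : s ≠ 0 := (zero_lt_one.trans_le hs1.out).ne'
  rcases le_total s r with h | h
  · rw [max_eq_right, Real.rpow_zero, one_mul]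
    · exact norm_toLp_le_of_le h x
    · rw [sub_nonpos]
      exact ENNReal.toReal_mono (ENNReal.inv_ne_top.2 hs0) (ENNReal.inv_le_inv.2 h)
  · rw [max_eq_left]
    · let _ : MeasurableSpace ι := ⊤
      have := eLpNorm_le_eLpNorm_mul_rpow_measure_univ (f := x) (μ := Measure.count) h
        (measurable_from_top).aestronglyMeasurable
      rw [← enorm_toLp_eq_eLpNorm_count, ← enorm_toLp_eq_eLpNorm_count, Measure.count_univ] at this
      have h2 := ENNReal.toReal_mono (by
        refine ENNReal.mul_ne_top (by simp) (ENNReal.rpow_ne_top_of_ne_zero ?_ ?_) <;> simp) this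
      rw [ENNReal.toReal_mul, toReal_enorm, toReal_enorm, ← ENNReal.toReal_rpow] at h2
      simpa [mul_comm, ENNReal.toReal_inv] using h2
    · rw [sub_nonneg]
      exact ENNReal.toReal_mono (ENNReal.inv_ne_top.2 hr0) (ENNReal.inv_le_inv.2 h)

theorem sum_mul_le_norm_toLp_mul_norm_toLp {r s : ℝ≥0∞} [hr1 : Fact (1 ≤ r)] [hs1 : Fact (1 ≤ s)]
    (hrs : ENNReal.HolderConjugate r s) (x y : ι → ℝ) :
    ∑ i, x i * y i ≤ ‖WithLp.toLp r x‖ * ‖WithLp.toLp s y‖ := by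
  let _ : MeasurableSpace ι := ⊤
  have := eLpNorm_smul_le_mul_eLpNorm (μ := Measure.count) (p := r) (q := s) (r := 1)
    (f := y) (φ := x) measurable_from_top.aestronglyMeasurable
    measurable_from_top.aestronglyMeasurable
  rw [← enorm_toLp_eq_eLpNorm_count, ← enorm_toLp_eq_eLpNorm_count,
    ← enorm_toLp_eq_eLpNorm_count] at this
  have h2 := ENNReal.toReal_mono (ENNReal.mul_ne_top (by simp) (by simp)) this
  rw [ENNReal.toReal_mul, toReal_enorm, toReal_enorm, toReal_enorm, PiLp.norm_eq_of_L1] at h2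
  refine le_trans (Finset.sum_le_sum fun i _ => ?_) h2
  exact le_abs_self _

/-- Every vector has a norming vector in the unit ball of the conjugate space. -/
theorem exists_norming_toLp {r s : ℝ≥0∞} [hr1 : Fact (1 ≤ r)] [hs1 : Fact (1 ≤ s)]
    (hrs : ENNReal.HolderConjugate r s) (hs : s ≠ ∞) (v : ι → ℝ) :
    ∃ x : ι → ℝ, ‖WithLp.toLp r x‖ ≤ 1 ∧ ∑ i, x i * v i = ‖WithLp.toLp s v‖ := by
  have hs0 : 0 < s.toReal := ENNReal.toReal_pos (zero_lt_one.trans_le hs1.out).ne' hs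
  have hs1' : 1 ≤ s.toReal := by simpa using ENNReal.toReal_mono hs hs1.out
  set N := ‖WithLp.toLp s v‖ with hN
  have hNs : N ^ s.toReal = ∑ i, |v i| ^ s.toReal := by
    rw [hN, norm_toLp_eq_sum_rpow hs1.out hs,
      ← Real.rpow_mul (Finset.sum_nonneg fun i _ => by positivity),
      one_div_mul_cancel hs0.ne', Real.rpow_one]
  have hap : ∀ i, |v i| ≤ N := fun i => PiLp.norm_apply_le (WithLp.toLp s v) i
  rcases (norm_nonneg (WithLp.toLp s v)).eq_or_lt with h0 | hpos
  · refine ⟨0, by simp, ?_⟩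
    simp [hN, ← h0]
  change 0 < N at hpos
  -- The equality case of Hölder. For `s = 1` the power is identically one and `x` is the sign
  -- vector.
  set x : ι → ℝ := fun i => SignType.sign (v i) * (|v i| / N) ^ (s.toReal - 1) with hx
  have hxabs : ∀ i, |x i| ≤ (|v i| / N) ^ (s.toReal - 1) := fun i => by
    rw [hx, abs_mul, abs_of_nonneg (a := (|v i| / N) ^ (s.toReal - 1)) (by positivity)]
    refine mul_le_of_le_one_left (by positivity) ?_
    rcases lt_trichotomy (v i) 0 with h | h | h <;> simp [h, sign_neg, sign_pos]
  refine ⟨x, ?_, ?_⟩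
  · by_cases hr : r = ∞
    · subst hr
      rw [PiLp.norm_toLp]
      refine (pi_norm_le_iff_of_nonneg zero_le_one).2 fun i => (hxabs i).trans ?_
      exact Real.rpow_le_one (by positivity) ((div_le_one hpos).2 (hap i)) (by linarith)
    · have hr0 : 0 < r.toReal := ENNReal.toReal_pos (zero_lt_one.trans_le hr1.out).ne' hr
      have hconj : r.toReal⁻¹ + s.toReal⁻¹ = 1 := by
        have := ENNReal.HolderConjugate.inv_add_inv_eq_one r s
        have h2 := congrArg ENNReal.toReal this
        rw [ENNReal.toReal_add (by simp [(zero_lt_one.trans_le hr1.out).ne'])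
          (by simp [(zero_lt_one.trans_le hs1.out).ne'])] at h2
        simpa using h2
      have hmul : (s.toReal - 1) * r.toReal = s.toReal := by
        field_simp at hconj
        linarith
      rw [norm_toLp_eq_sum_rpow hr1.out hr]
      refine Real.rpow_le_one (Finset.sum_nonneg fun i _ => by positivity) ?_ (by positivity)
      calc ∑ i, |x i| ^ r.toReal ≤ ∑ i, |v i| ^ s.toReal / N ^ s.toReal :=
            Finset.sum_le_sum fun i _ => by
              refine (Real.rpow_le_rpow (abs_nonneg _) (hxabs i) hr0.le).trans (le_of_eq ?_)
              rw [← Real.rpow_mul (by positivity), hmul, Real.div_rpow (abs_nonneg _) hpos.le]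
        _ = 1 := by
            rw [← Finset.sum_div, ← hNs, div_self (by positivity)]
  · calc ∑ i, x i * v i = ∑ i, |v i| ^ s.toReal * (N ^ (s.toReal - 1))⁻¹ :=
          Finset.sum_congr rfl fun i _ => by
            have e : x i * v i = |v i| * (|v i| / N) ^ (s.toReal - 1) := by
              simp only [hx]
              linear_combination (|v i| / N) ^ (s.toReal - 1) * sign_mul_self (v i)
            rw [e, Real.div_rpow (abs_nonneg _) hpos.le]
            rcases (abs_nonneg (v i)).eq_or_lt with h | h
            · rw [← h, Real.zero_rpow hs0.ne']; ring
            · rw [Real.rpow_sub_one h.ne']; field_simp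
      _ = N := by
          rw [← Finset.sum_mul, ← hNs, Real.rpow_sub_one hpos.ne']
          field_simp

end PiLpNorms

/-! ### Linear images of standard Gaussian vectors -/

/-- The law of a vector of independent standard Gaussian variables indexed by `κ`. -/
noncomputable abbrev stdGaussianPi (κ : Type*) [Fintype κ] : Measure (κ → ℝ) :=
  Measure.pi fun _ : κ => gaussianReal 0 1

section StdGaussianPi
variable {κ κ' ι : Type*} [Fintype κ] [Fintype κ'] [Fintype ι]

instance isGaussian_stdGaussianPi : IsGaussian (stdGaussianPi κ) := by
  have h : HasGaussianLaw (fun (g : κ → ℝ) i => g i) (stdGaussianPi κ) :=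
    iIndepFun.hasGaussianLaw
      (fun i => ((measurePreserving_eval (fun _ : κ => gaussianReal 0 1) i).hasLaw).hasGaussianLaw)
      (iIndepFun_pi (X := fun _ x => x) fun _ => aemeasurable_id)
  simpa using h.isGaussian_map

theorem integral_id_stdGaussianPi : (stdGaussianPi κ)[id] = 0 := by
  ext i
  have h := IsGaussian.integral_dual (μ := stdGaussianPi κ) (ContinuousLinearMap.proj (R := ℝ) i)
  have h2 := integral_comp_eval (μ := fun _ : κ => gaussianReal 0 1) (i := i)
    (f := fun x : ℝ => x) (by fun_prop)
  simp only [integral_id_gaussianReal] at h2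
  simp only [ContinuousLinearMap.proj_apply] at h
  simpa using h.symm.trans h2

/-- The linear map with rows `a i`. -/
noncomputable def rowsCLM (a : ι → κ → ℝ) : (κ → ℝ) →L[ℝ] (ι → ℝ) :=
  LinearMap.toContinuousLinearMap (Matrix.mulVecLin (Matrix.of a))

theorem rowsCLM_apply {κ ι : Type*} [Fintype κ] [Fintype ι] (a : ι → κ → ℝ) (g : κ → ℝ) (i : ι) :
    rowsCLM a g i = ∑ k, a i k * g k := rfl

theorem integral_sq_sum_mul_stdGaussianPi (c : κ → ℝ) :
    ∫ g, (∑ k, c k * g k) ^ 2 ∂(stdGaussianPi κ) = ∑ k, c k ^ 2 := by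
  have hm : ∫ g, ∑ k, c k * g k ∂(stdGaussianPi κ) = 0 := by
    rw [integral_finsetSum _ fun k _ => ((memLp_two_eval k).integrable (by norm_num)).const_mul _]
    simp [integral_const_mul, integral_eval_eq_zero integral_id_stdGaussianPi]
  have hmem : ∀ k, MemLp (fun x : ℝ => c k * x) 2 (gaussianReal 0 1) := fun k =>
    (memLp_id_gaussianReal' 2 (by simp)).const_mul (c k)
  have h := variance_sum_pi (μ := fun _ : κ => gaussianReal 0 1) hmem
  have e : (∑ k, fun g : κ → ℝ => c k * g k) = fun g => ∑ k, c k * g k := by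
    ext g; simp
  rw [e, variance_eq_integral (Measurable.aemeasurable (Finset.measurable_fun_sum _
    fun k _ => (measurable_pi_apply k).const_mul _)), hm] at h
  simp only [sub_zero] at h
  rw [h]
  refine Finset.sum_congr rfl fun k _ => ?_
  rw [variance_const_mul, variance_fun_id_gaussianReal]
  simp

theorem integral_id_map_rowsCLM (a : ι → κ → ℝ) :
    ((stdGaussianPi κ).map (rowsCLM a))[id] = 0 := by
  rw [integral_map (by fun_prop) (by fun_prop)]
  have h := integral_id_stdGaussianPi (κ := κ)
  simp only [id] at h ⊢
  rw [(rowsCLM a).integral_comp_comm (φ := fun x => x) IsGaussian.integrable_id, h, map_zero]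

/-- **Sudakov–Fernique inequality** for linear forms in independent standard Gaussians. -/
theorem integral_iSup_linear_le [Nonempty ι] (a : ι → κ → ℝ) (b : ι → κ' → ℝ)
    (h : ∀ i j, ∑ k, (a i k - a j k) ^ 2 ≤ ∑ k, (b i k - b j k) ^ 2) :
    ∫ g, ⨆ i, ∑ k, a i k * g k ∂(stdGaussianPi κ) ≤
      ∫ g, ⨆ i, ∑ k, b i k * g k ∂(stdGaussianPi κ') := by
  have key := sudakov_fernique (integral_id_map_rowsCLM a) (integral_id_map_rowsCLM b)
    fun i j => by
      rw [integral_map (by fun_prop) (by fun_prop), integral_map (by fun_prop) (by fun_prop)]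
      simp only [rowsCLM_apply, ← Finset.sum_sub_distrib, ← sub_mul]
      rw [integral_sq_sum_mul_stdGaussianPi, integral_sq_sum_mul_stdGaussianPi]
      exact h i j
  rw [integral_map (by fun_prop) continuous_iSup_pi.aestronglyMeasurable,
    integral_map (by fun_prop) continuous_iSup_pi.aestronglyMeasurable] at key
  exact key

theorem variance_strongDual_map_rowsCLM [DecidableEq ι] (a : ι → κ → ℝ)
    (L : StrongDual ℝ (ι → ℝ)) : Var[L; (stdGaussianPi κ).map (rowsCLM a)] =
      ∑ i, ∑ j, L (Pi.single i 1) * L (Pi.single j 1) * ∑ k, a i k * a j k := by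
  have hL : ∀ x, L x = ∑ i, L (Pi.single i 1) * x i := fun x => by
    conv_lhs => rw [pi_eq_sum_univ' x, map_sum]
    refine Finset.sum_congr rfl fun i _ => ?_
    rw [map_smul, smul_eq_mul, mul_comm]
  rw [variance_eq_integral (by fun_prop), IsGaussian.integral_dual]
  have := integral_id_map_rowsCLM a
  simp only [id] at this
  rw [this, map_zero, integral_map (by fun_prop) (by fun_prop)]
  have e : ∀ g, (L (rowsCLM a g) - 0) ^ 2 =
      (∑ k, (∑ i, L (Pi.single i 1) * a i k) * g k) ^ 2 := fun g => by
    rw [sub_zero, hL]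
    simp only [rowsCLM_apply, Finset.mul_sum, Finset.sum_mul]
    rw [Finset.sum_comm]
    simp only [mul_assoc]
  simp only [e]
  rw [integral_sq_sum_mul_stdGaussianPi]
  have e2 : ∀ k, (∑ i, L (Pi.single i 1) * a i k) ^ 2 =
      ∑ i, ∑ j, (L (Pi.single i 1) * a i k) * (L (Pi.single j 1) * a j k) := fun k => by
    rw [sq, Finset.sum_mul_sum]
  simp only [e2, Finset.mul_sum]
  rw [Finset.sum_comm]
  refine Finset.sum_congr rfl fun i _ => ?_
  rw [Finset.sum_comm]
  exact Finset.sum_congr rfl fun j _ => Finset.sum_congr rfl fun k _ => by ring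

/-- The law of a linear image of a standard Gaussian vector depends only on the Gram matrix. -/
theorem map_rowsCLM_eq (a : ι → κ → ℝ) (b : ι → κ' → ℝ)
    (h : ∀ i j, ∑ k, a i k * a j k = ∑ k, b i k * b j k) :
    (stdGaussianPi κ).map (rowsCLM a) = (stdGaussianPi κ').map (rowsCLM b) := by
  classical
  apply Measure.ext_of_charFunDual
  ext L
  rw [IsGaussian.charFunDual_eq_of_integral_eq_zero (integral_id_map_rowsCLM a),
    IsGaussian.charFunDual_eq_of_integral_eq_zero (integral_id_map_rowsCLM b),
    variance_strongDual_map_rowsCLM, variance_strongDual_map_rowsCLM]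
  simp only [h]

theorem measurePreserving_stdGaussianPi_inl :
    MeasurePreserving (fun (g : κ ⊕ κ' → ℝ) k => g (Sum.inl k)) (stdGaussianPi (κ ⊕ κ'))
      (stdGaussianPi κ) :=
  measurePreserving_fst.comp
    (measurePreserving_sumPiEquivProdPi (X := fun _ : κ ⊕ κ' => ℝ) fun _ => gaussianReal 0 1)

theorem measurePreserving_stdGaussianPi_inr :
    MeasurePreserving (fun (g : κ ⊕ κ' → ℝ) k => g (Sum.inr k)) (stdGaussianPi (κ ⊕ κ'))
      (stdGaussianPi κ') :=
  measurePreserving_snd.comp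
    (measurePreserving_sumPiEquivProdPi (X := fun _ : κ ⊕ κ' => ℝ) fun _ => gaussianReal 0 1)

end StdGaussianPi

/-! ### Growth of the expected `ℓ_r` norm -/

section GaussianNorm

theorem continuous_norm_toLp {κ : Type*} [Fintype κ] (r : ℝ≥0∞) [Fact (1 ≤ r)] :
    Continuous fun g : κ → ℝ => ‖WithLp.toLp r g‖ :=
  (PiLp.continuous_toLp r _).norm

theorem integrable_norm_toLp {κ : Type*} [Fintype κ] (r : ℝ≥0∞) [hr : Fact (1 ≤ r)] :
    Integrable (fun g : κ → ℝ => ‖WithLp.toLp r g‖) (stdGaussianPi κ) := by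
  refine Integrable.mono' (g := fun g : κ → ℝ => ∑ k, |g k|)
    (integrable_finsetSum _ fun k _ =>
      ((memLp_two_eval (μ := stdGaussianPi κ) k).integrable (by norm_num)).abs)
    (continuous_norm_toLp r).aestronglyMeasurable (.of_forall fun g => ?_)
  rw [norm_norm]
  refine (norm_toLp_le_of_le (s := 1) hr.out g).trans (le_of_eq ?_)
  rw [PiLp.norm_eq_of_L1]; rfl

/-- The expected `ℓ_r`-norm of a standard Gaussian vector in `ℝⁿ`. -/
noncomputable def expNorm (r : ℝ≥0∞) (n : ℕ) : ℝ :=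
  ∫ g, ‖WithLp.toLp r g‖ ∂(stdGaussianPi (Fin n))

theorem expNorm_nonneg (r : ℝ≥0∞) [Fact (1 ≤ r)] (n : ℕ) : 0 ≤ expNorm r n :=
  integral_nonneg fun _ => norm_nonneg _

theorem expNorm_le_of_le {r s : ℝ≥0∞} [Fact (1 ≤ r)] [Fact (1 ≤ s)] (h : s ≤ r) (n : ℕ) :
    expNorm r n ≤ expNorm s n :=
  integral_mono (integrable_norm_toLp r) (integrable_norm_toLp s) fun g => norm_toLp_le_of_le h g

theorem memLp_abs_rpow_gaussianReal {a : ℝ} (ha : 0 < a) :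
    MemLp (fun z : ℝ => |z| ^ a) 2 (gaussianReal 0 1) := by
  have h := (memLp_id_gaussianReal' (μ := 0) (v := 1) (2 * ENNReal.ofReal a)
    (ENNReal.mul_ne_top (by simp) (by simp))).norm_rpow_div (ENNReal.ofReal a)
  have e : 2 * ENNReal.ofReal a / ENNReal.ofReal a = 2 :=
    ENNReal.mul_div_cancel_right (by simpa using ha) (by simp)
  rw [e, ENNReal.toReal_ofReal ha.le] at h
  exact h

theorem integral_abs_rpow_gaussianReal_pos {a : ℝ} (ha : 0 < a) :
    0 < ∫ z : ℝ, |z| ^ a ∂gaussianReal 0 1 := by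
  have hint := (memLp_abs_rpow_gaussianReal ha).integrable (by norm_num)
  rw [integral_pos_iff_support_of_nonneg (fun z => by positivity) hint]
  have hs : (Function.support fun z : ℝ => |z| ^ a) = {0}ᶜ := by
    ext z
    simp [Function.mem_support, Real.rpow_eq_zero_iff_of_nonneg (abs_nonneg z), ha.ne']
  have hna := nullSingletonClass_gaussianReal (μ := 0) (v := 1) one_ne_zero
  rw [hs, prob_compl_eq_one_sub (measurableSet_singleton 0), measure_singleton]
  simp

variable {r : ℝ≥0∞}

/-- The normalized power sum `∑ |gᵢ|^r / (n m)` has mean one and second moment about one `V / n`. -/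
theorem exists_integral_normalized_power_sum {a : ℝ} (ha : 0 < a) :
    ∃ V : ℝ, ∀ n : ℕ, 0 < n → ∃ t : (Fin n → ℝ) → ℝ,
      (∀ g, ∑ i, |g i| ^ a = (n * ∫ z : ℝ, |z| ^ a ∂gaussianReal 0 1) * t g) ∧ (∀ g, 0 ≤ t g) ∧
      Integrable t (stdGaussianPi (Fin n)) ∧ ∫ g, t g ∂(stdGaussianPi (Fin n)) = 1 ∧
      Integrable (fun g => (t g - 1) ^ 2) (stdGaussianPi (Fin n)) ∧
      ∫ g, (t g - 1) ^ 2 ∂(stdGaussianPi (Fin n)) = V / n := by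
  set m := ∫ z : ℝ, |z| ^ a ∂gaussianReal 0 1 with hm
  have hmpos : 0 < m := integral_abs_rpow_gaussianReal_pos ha
  have hmem := memLp_abs_rpow_gaussianReal ha
  refine ⟨Var[fun z : ℝ => |z| ^ a; gaussianReal 0 1] / m ^ 2, fun n hn => ?_⟩
  have hn' : (0 : ℝ) < n := by exact_mod_cast hn
  have hmem' : ∀ i : Fin n, MemLp (fun g : Fin n → ℝ => |g i| ^ a) 2 (stdGaussianPi (Fin n)) :=
    fun i => hmem.comp_measurePreserving (measurePreserving_eval _ i)
  have hS : MemLp (fun g : Fin n → ℝ => ∑ i, |g i| ^ a) 2 (stdGaussianPi (Fin n)) :=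
    memLp_finsetSum _ fun i _ => hmem' i
  have hmean : ∫ g, ∑ i, |g i| ^ a ∂(stdGaussianPi (Fin n)) = n * m := by
    rw [integral_finsetSum _ fun i _ => (hmem' i).integrable (by norm_num)]
    have : ∀ i : Fin n, ∫ g, |g i| ^ a ∂(stdGaussianPi (Fin n)) = m := fun i =>
      integral_comp_eval (μ := fun _ : Fin n => gaussianReal 0 1) (i := i)
        (f := fun x : ℝ => |x| ^ a) hmem.1
    simp [this]
  have hvar := variance_sum_pi (μ := fun _ : Fin n => gaussianReal 0 1) fun _ => hmem
  have e : (∑ i, fun g : Fin n → ℝ => |g i| ^ a) = fun g => ∑ i, |g i| ^ a := by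
    ext g; simp
  rw [e, variance_eq_integral hS.1.aemeasurable, hmean] at hvar
  have hnm : (n * m : ℝ) ≠ 0 := by positivity
  have esq : ∀ g : Fin n → ℝ, ((∑ i, |g i| ^ a) / (n * m) - 1) ^ 2 =
      ((n * m) ^ 2)⁻¹ * (∑ i, |g i| ^ a - n * m) ^ 2 := fun g => by
    field_simp
  refine ⟨fun g => (∑ i, |g i| ^ a) / (n * m), fun g => (mul_div_cancel₀ _ hnm).symm,
    fun g => by positivity, (hS.integrable (by norm_num)).div_const _, ?_, ?_, ?_⟩
  · rw [integral_div, hmean, div_self hnm]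
  · simp only [esq]
    exact ((hS.sub (memLp_const (n * m))).integrable_sq).const_mul _
  · simp only [esq]
    rw [integral_const_mul, hvar]
    simp only [Finset.sum_const, Finset.card_univ, Fintype.card_fin, nsmul_eq_mul]
    field_simp

theorem gaussianXi_pos [hr1 : Fact (1 ≤ r)] (hr : r ≠ ∞) : 0 < gaussianXi r :=
  Real.rpow_pos_of_pos (integral_abs_rpow_gaussianReal_pos
    (ENNReal.toReal_pos (zero_lt_one.trans_le hr1.out).ne' hr)) _

/-- The norm is `n^{1/r} ξ_r t^{1/r}` with `E t = 1` and `E (t - 1)² = V / n`. Concavity of the root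
(Bernoulli) bounds its mean above by one; `t^{1/r} ≥ 1 - |t - 1|` bounds it below. -/
theorem expNorm_bounds [hr1 : Fact (1 ≤ r)] (hr : r ≠ ∞) :
    ∃ C : ℝ, ∀ n : ℕ, 0 < n →
      expNorm r n ≤ (n : ℝ) ^ (r⁻¹).toReal * gaussianXi r ∧
      (n : ℝ) ^ (r⁻¹).toReal * gaussianXi r * (1 - C * (√n)⁻¹) ≤ expNorm r n := by
  have ha : 0 < r.toReal := ENNReal.toReal_pos (zero_lt_one.trans_le hr1.out).ne' hr
  have ha1 : 1 ≤ r.toReal := by simpa using ENNReal.toReal_mono hr hr1.out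
  obtain ⟨V, hV⟩ := exists_integral_normalized_power_sum ha
  refine ⟨(1 + V) / 2, fun n hn => ?_⟩
  obtain ⟨t, ht, ht0, hti, htm, htsi, hts⟩ := hV n hn
  have hn' : (0 : ℝ) < n := by exact_mod_cast hn
  have hinv : (r⁻¹).toReal = 1 / r.toReal := by rw [ENNReal.toReal_inv, one_div]
  have hs0 : 0 < 1 / r.toReal := by positivity
  have hs1 : 1 / r.toReal ≤ 1 := by rw [div_le_one ha]; exact ha1
  set m := ∫ z : ℝ, |z| ^ r.toReal ∂gaussianReal 0 1 with hm
  have hmpos : 0 < m := integral_abs_rpow_gaussianReal_pos ha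
  set K := (n : ℝ) ^ (r⁻¹).toReal * gaussianXi r with hK
  have hK0 : 0 ≤ K := mul_nonneg (by positivity) (gaussianXi_pos hr).le
  have hN : ∀ g : Fin n → ℝ, ‖WithLp.toLp r g‖ = K * t g ^ (1 / r.toReal) := fun g => by
    rw [norm_toLp_eq_sum_rpow hr1.out hr, ht, Real.mul_rpow (by positivity) (ht0 g),
      Real.mul_rpow hn'.le hmpos.le, hK, hinv, gaussianXi, ← hm]
  have hroot : Integrable (fun g => K * t g ^ (1 / r.toReal)) (stdGaussianPi (Fin n)) := by
    simpa only [hN] using integrable_norm_toLp (κ := Fin n) r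
  have hexp : expNorm r n = ∫ g, K * t g ^ (1 / r.toReal) ∂(stdGaussianPi (Fin n)) := by
    simp only [expNorm, hN]
  constructor
  · have i0 : Integrable (fun g => 1 / r.toReal * (t g - 1)) (stdGaussianPi (Fin n)) :=
      (hti.sub (integrable_const 1)).const_mul _
    have i3 : Integrable (fun g => 1 + 1 / r.toReal * (t g - 1)) (stdGaussianPi (Fin n)) :=
      (integrable_const 1).add i0
    rw [hexp]
    calc _ ≤ ∫ g, K * (1 + 1 / r.toReal * (t g - 1)) ∂(stdGaussianPi (Fin n)) := by
          refine integral_mono hroot (i3.const_mul K)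
            fun g => mul_le_mul_of_nonneg_left ?_ hK0
          have := rpow_one_add_le_one_add_mul_self (s := t g - 1) (p := 1 / r.toReal)
            (by linarith [ht0 g]) hs0.le hs1
          simpa using this
      _ = K := by
          rw [integral_const_mul, integral_add (integrable_const 1) i0, integral_const_mul,
            integral_sub hti (integrable_const 1), htm]
          simp
  · rw [hexp]
    have hsq : 0 < √(n : ℝ) := by positivity
    have i1 : Integrable (fun g => √(n : ℝ) / 2 * (t g - 1) ^ 2) (stdGaussianPi (Fin n)) :=
      htsi.const_mul _
    have i4 : Integrable (fun g => (√(n : ℝ))⁻¹ / 2 + √n / 2 * (t g - 1) ^ 2)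
      (stdGaussianPi (Fin n)) := (integrable_const _).add i1
    have i2 : Integrable (fun g => 1 - ((√(n : ℝ))⁻¹ / 2 + √n / 2 * (t g - 1) ^ 2))
      (stdGaussianPi (Fin n)) := (integrable_const 1).sub i4
    calc K * (1 - (1 + V) / 2 * (√n)⁻¹)
        = ∫ g, K * (1 - ((√(n : ℝ))⁻¹ / 2 + √n / 2 * (t g - 1) ^ 2))
            ∂(stdGaussianPi (Fin n)) := by
          rw [integral_const_mul, integral_sub (integrable_const 1) i4, integral_add (integrable_const _) i1,
            integral_const_mul, hts]
          have : √(n : ℝ) / 2 * (V / n) = V / 2 * (√(n : ℝ))⁻¹ := by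
            nth_rewrite 2 [← Real.mul_self_sqrt hn'.le]
            field_simp
          rw [this]
          simp
          left; ring
      _ ≤ _ := integral_mono (i2.const_mul K) hroot fun g => by
          refine mul_le_mul_of_nonneg_left ?_ hK0
          have h1 : 1 - |t g - 1| ≤ t g ^ (1 / r.toReal) := by
            rcases le_total (t g) 1 with h | h
            · rw [abs_of_nonpos (by linarith)]
              have := Real.rpow_le_rpow_of_exponent_ge' (ht0 g) h hs0.le hs1
              rw [Real.rpow_one] at this
              linarith
            · have := Real.one_le_rpow h hs0.le
              linarith [abs_nonneg (t g - 1)]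
          -- AM-GM with weight `√n`, which makes both terms of order `1/√n` in mean; hence `C = (1 +
          -- V) / 2`.
          have h2 : |t g - 1| ≤ (√(n : ℝ))⁻¹ / 2 + √n / 2 * (t g - 1) ^ 2 := by
            have h3 := sq_nonneg (√(n : ℝ) * |t g - 1| - 1)
            have h4 : √(n : ℝ) * (√(n : ℝ))⁻¹ = 1 := mul_inv_cancel₀ hsq.ne'
            rw [← sq_abs (t g - 1)]
            refine le_of_mul_le_mul_left ?_ hsq
            nlinarith
          linarith

theorem tendsto_rpow_neg_mul_expNorm [hr1 : Fact (1 ≤ r)] (hr : r ≠ ∞) :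
    Tendsto (fun n : ℕ => (n : ℝ) ^ (-(r⁻¹).toReal) * expNorm r n) atTop
      (𝓝 (gaussianXi r)) := by
  obtain ⟨C, hC⟩ := expNorm_bounds hr
  have lim : Tendsto (fun n : ℕ => gaussianXi r * (1 - C * (√(n : ℝ))⁻¹)) atTop
      (𝓝 (gaussianXi r * (1 - C * 0))) := by
    refine ((Tendsto.const_mul C ?_).const_sub 1).const_mul _
    exact (Real.tendsto_sqrt_atTop.comp tendsto_natCast_atTop_atTop).inv_tendsto_atTop
  rw [mul_zero, sub_zero, mul_one] at lim
  refine tendsto_of_tendsto_of_tendsto_of_le_of_le' lim tendsto_const_nhds ?_ ?_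
  all_goals
    filter_upwards [eventually_gt_atTop 0] with n hn
    have hn' : (0 : ℝ) < n := by exact_mod_cast hn
    have hpos : 0 < (n : ℝ) ^ (-(r⁻¹).toReal) := by positivity
    have hcancel : (n : ℝ) ^ (-(r⁻¹).toReal) * (n : ℝ) ^ (r⁻¹).toReal = 1 := by
      rw [← Real.rpow_add hn']; simp
  · refine le_trans (le_of_eq ?_) (mul_le_mul_of_nonneg_left (hC n hn).2 hpos.le)
    rw [← mul_assoc, ← mul_assoc, hcancel, one_mul]
  · refine (mul_le_mul_of_nonneg_left (hC n hn).1 hpos.le).trans (le_of_eq ?_)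
    rw [← mul_assoc, hcancel, one_mul]

/-- `E ‖g‖_r` grows no faster than any power of `n` larger than `1 / r`, also for `r = ∞`. -/
theorem tendsto_rpow_neg_mul_expNorm_zero [hr1 : Fact (1 ≤ r)] {e : ℝ} (he : (r⁻¹).toReal < e) :
    Tendsto (fun n : ℕ => (n : ℝ) ^ (-e) * expNorm r n) atTop (𝓝 0) := by
  -- For `r = ∞` the norm is dominated by a finite `ℓ_s` norm with `1/s < e`.
  obtain ⟨s, hs1, hs, hsr, hse⟩ : ∃ s : ℝ≥0∞, 1 ≤ s ∧ s ≠ ∞ ∧ s ≤ r ∧ (s⁻¹).toReal < e := by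
    by_cases hr : r = ∞
    · subst hr
      have he0 : 0 < e := by simpa using he
      refine ⟨ENNReal.ofReal (max 1 (2 / e)), ?_, by simp, le_top, ?_⟩
      · rw [ENNReal.one_le_ofReal]; exact le_max_left _ _
      · rw [ENNReal.toReal_inv, ENNReal.toReal_ofReal (by positivity)]
        refine inv_lt_of_inv_lt₀ he0 (lt_of_lt_of_le ?_ (le_max_right _ _))
        rw [inv_eq_one_div]
        gcongr
        norm_num
    · exact ⟨r, hr1.out, hr, le_rfl, he⟩
  have : Fact (1 ≤ s) := ⟨hs1⟩
  obtain ⟨C, hC⟩ := expNorm_bounds hs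
  have lim : Tendsto (fun n : ℕ => (n : ℝ) ^ (-(e - (s⁻¹).toReal)) * gaussianXi s) atTop
      (𝓝 (0 * gaussianXi s)) :=
    ((tendsto_rpow_neg_atTop (by linarith)).comp tendsto_natCast_atTop_atTop).mul_const _
  rw [zero_mul] at lim
  refine tendsto_of_tendsto_of_tendsto_of_le_of_le' tendsto_const_nhds lim ?_ ?_
  · exact .of_forall fun n => mul_nonneg (by positivity) (expNorm_nonneg r n)
  · filter_upwards [eventually_gt_atTop 0] with n hn
    have hn' : (0 : ℝ) < n := by exact_mod_cast hn
    have hpos : 0 < (n : ℝ) ^ (-e) := by positivity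
    refine (mul_le_mul_of_nonneg_left ((expNorm_le_of_le hsr n).trans (hC n hn).1)
      hpos.le).trans (le_of_eq ?_)
    rw [← mul_assoc, ← Real.rpow_add hn']
    congr 2; ring

end GaussianNorm

/-! ### The operator norm as a supremum of bilinear forms -/

section OpNorm
variable {n : ℕ} {p q : ℝ≥0∞}

/-- The matrix with entries `g (i, j)`, as an operator `ℓ_p → ℓ_q`, linear in `g`. -/
noncomputable def entriesToCLM (n : ℕ) (p q : ℝ≥0∞) [Fact (1 ≤ p)] [Fact (1 ≤ q)] :
    (Fin n × Fin n → ℝ) →ₗ[ℝ] (PiLp p fun _ : Fin n => ℝ) →L[ℝ] PiLp q fun _ : Fin n => ℝ where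
  toFun g := LinearMap.toContinuousLinearMap ((WithLp.linearEquiv q ℝ (Fin n → ℝ)).symm.toLinearMap
    ∘ₗ (Matrix.of fun i j => g (i, j)).mulVecLin ∘ₗ (WithLp.linearEquiv p ℝ (Fin n → ℝ)).toLinearMap)
  map_add' g h := by
    ext x i
    simp [Matrix.mulVec, dotProduct, add_mul, Finset.sum_add_distrib]
  map_smul' c g := by
    ext x i
    simp [Matrix.mulVec, dotProduct, Finset.mul_sum, mul_assoc]

variable [hp : Fact (1 ≤ p)] [hq : Fact (1 ≤ q)]

theorem entriesToCLM_apply (g : Fin n × Fin n → ℝ) (x : Fin n → ℝ) :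
    entriesToCLM n p q g (WithLp.toLp p x) =
      WithLp.toLp q ((Matrix.of fun i j => g (i, j)) *ᵥ x) := rfl

theorem matrixOpNorm_eq_norm (g : Fin n × Fin n → ℝ) :
    matrixOpNorm p q (Matrix.of fun i j => g (i, j)) = ‖entriesToCLM n p q g‖ := by
  rw [← ContinuousLinearMap.sSup_sphere_eq_norm, matrixOpNorm, iSup]
  congr 1
  ext c
  constructor
  · rintro ⟨⟨x, hx⟩, rfl⟩
    exact ⟨x, by simpa using hx, rfl⟩
  · rintro ⟨x, hx, rfl⟩
    exact ⟨⟨x, by simpa using hx⟩, rfl⟩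

theorem continuous_norm_entriesToCLM :
    Continuous fun g : Fin n × Fin n → ℝ => ‖entriesToCLM n p q g‖ :=
  (LinearMap.continuous_of_finiteDimensional (entriesToCLM n p q)).norm

theorem integrable_norm_entriesToCLM :
    Integrable (fun g => ‖entriesToCLM n p q g‖) (stdGaussianPi (Fin n × Fin n)) := by
  refine Integrable.mono' (IsGaussian.integrable_id.norm.const_mul
    ‖LinearMap.toContinuousLinearMap (entriesToCLM n p q)‖)
    continuous_norm_entriesToCLM.aestronglyMeasurable (.of_forall fun g => ?_)
  rw [norm_norm]
  exact (LinearMap.toContinuousLinearMap (entriesToCLM n p q)).le_opNorm g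

/-- The functionals on `ℝⁿ` of norm at most one with respect to `‖·‖_q`. -/
def dualBall (n : ℕ) (q : ℝ≥0∞) : Set (Fin n → ℝ) :=
  {y | ∀ v : Fin n → ℝ, ∑ i, y i * v i ≤ ‖WithLp.toLp q v‖}

/-- Hahn–Banach, read in coordinates; it covers `q = ∞` as well. -/
theorem exists_mem_dualBall (w : Fin n → ℝ) :
    ∃ y ∈ dualBall n q, ∑ i, y i * w i = ‖WithLp.toLp q w‖ := by
  obtain ⟨f, hf, hfw⟩ := exists_dual_vector'' ℝ (WithLp.toLp q w)
  have hsum : ∀ v : Fin n → ℝ, f (WithLp.toLp q v) =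
      ∑ i, f (WithLp.toLp q (Pi.single i 1)) * v i := fun v => by
    have : WithLp.toLp q v = ∑ i, v i • WithLp.toLp q (Pi.single i (1 : ℝ)) := by
      ext j
      simp [Pi.single_apply]
    conv_lhs => rw [this, map_sum]
    exact Finset.sum_congr rfl fun i _ => by rw [map_smul, smul_eq_mul, mul_comm]
  refine ⟨fun i => f (WithLp.toLp q (Pi.single i 1)), fun v => ?_, ?_⟩
  · rw [← hsum]
    refine (le_abs_self _).trans ((f.le_opNorm _).trans ?_)
    exact mul_le_of_le_one_left (norm_nonneg _) hf
  · rw [← hsum, hfw]; rfl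

theorem mem_dualBall_of_norm_le_one {q' : ℝ≥0∞} [Fact (1 ≤ q')]
    (h : ENNReal.HolderConjugate q' q) {y : Fin n → ℝ} (hy : ‖WithLp.toLp q' y‖ ≤ 1) :
    y ∈ dualBall n q := fun v =>
  (sum_mul_le_norm_toLp_mul_norm_toLp h y v).trans (mul_le_of_le_one_left (norm_nonneg _) hy)

theorem abs_apply_le_one_of_mem_dualBall {y : Fin n → ℝ} (hy : y ∈ dualBall n q) (i : Fin n) :
    |y i| ≤ 1 := by
  have h1 := hy (Pi.single i 1)
  have h2 := hy (Pi.single i (-1))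
  rw [PiLp.toLp_single, PiLp.norm_single] at h1 h2
  simp [Pi.single_apply] at h1 h2
  exact abs_le.2 ⟨by linarith, h1⟩

theorem sum_sq_eq_norm_toLp_two_sq (x : Fin n → ℝ) :
    ∑ i, x i ^ 2 = ‖WithLp.toLp 2 x‖ ^ 2 := by
  rw [PiLp.norm_sq_eq_of_L2]
  simp

theorem sqrt_sum_sq_eq_norm_toLp_two (x : Fin n → ℝ) :
    √(∑ i, x i ^ 2) = ‖WithLp.toLp 2 x‖ := by
  rw [sum_sq_eq_norm_toLp_two_sq, Real.sqrt_sq (norm_nonneg _)]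

/-- Testing `y` against itself gives `‖y‖₂² ≤ ‖y‖_q`, and `‖y‖_q` is at most the stated power of `n`
times `‖y‖₂`; one factor cancels. -/
theorem norm_toLp_two_le_of_mem_dualBall [NeZero n] {y : Fin n → ℝ} (hy : y ∈ dualBall n q) :
    ‖WithLp.toLp 2 y‖ ≤ (n : ℝ) ^ max ((q⁻¹).toReal - 1 / 2) 0 := by
  have h1 : ‖WithLp.toLp 2 y‖ ^ 2 ≤ ‖WithLp.toLp q y‖ := by
    rw [← sum_sq_eq_norm_toLp_two_sq]
    simpa only [sq] using hy y
  have h2 := norm_toLp_le_card_rpow_mul (r := q) (s := 2) y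
  rw [Fintype.card_fin, show ((2 : ℝ≥0∞)⁻¹).toReal = 1 / 2 by simp] at h2
  rcases (norm_nonneg (WithLp.toLp 2 y)).eq_or_lt with h0 | h0
  · rw [← h0]; positivity
  · refine le_of_mul_le_mul_right ?_ h0
    rw [← sq]
    exact h1.trans h2

theorem sum_mul_mulVec_le_norm (g : Fin n × Fin n → ℝ) {x y : Fin n → ℝ}
    (hx : ‖WithLp.toLp p x‖ ≤ 1) (hy : y ∈ dualBall n q) :
    ∑ i, y i * ((Matrix.of fun i j => g (i, j)) *ᵥ x) i ≤ ‖entriesToCLM n p q g‖ := by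
  refine (hy _).trans ?_
  rw [← entriesToCLM_apply (p := p)]
  exact ((entriesToCLM n p q g).le_opNorm _).trans (mul_le_of_le_one_right (norm_nonneg _) hx)

theorem sum_mul_mulVec_eq (g : Fin n × Fin n → ℝ) (x y : Fin n → ℝ) :
    ∑ i, y i * ((Matrix.of fun i j => g (i, j)) *ᵥ x) i =
      ∑ k : Fin n × Fin n, (y k.1 * x k.2) * g k := by
  rw [Fintype.sum_prod_type]
  refine Finset.sum_congr rfl fun i _ => ?_
  simp only [Matrix.mulVec, dotProduct, Matrix.of_apply, Finset.mul_sum]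
  exact Finset.sum_congr rfl fun j _ => by ring

end OpNorm

/-! ### Chevet's upper bound -/

section Chevet
variable {n : ℕ}

/-- Comparison of the increments of `⟨y, Gx⟩` with those of `R ⟨g, y⟩ + ‖y‖ ⟨h, x⟩`. -/
theorem sum_sq_sub_tensor_le {R : ℝ} {x x' : Fin n → ℝ} (y y' : Fin n → ℝ)
    (hx : ∑ i, x i ^ 2 ≤ R ^ 2) (hx' : ∑ i, x' i ^ 2 ≤ R ^ 2) :
    ∑ k : Fin n × Fin n, (y k.1 * x k.2 - y' k.1 * x' k.2) ^ 2 ≤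
      ∑ k : Fin n, (R * y k - R * y' k) ^ 2 +
        ∑ k : Fin n, (√(∑ i, y i ^ 2) * x k - √(∑ i, y' i ^ 2) * x' k) ^ 2 := by
  have hy0 : 0 ≤ ∑ i, y i ^ 2 := Finset.sum_nonneg fun i _ => sq_nonneg _
  have hy0' : 0 ≤ ∑ i, y' i ^ 2 := Finset.sum_nonneg fun i _ => sq_nonneg _
  have hA := Real.sum_mul_le_sqrt_mul_sqrt Finset.univ y y'
  set s := √(∑ i, y i ^ 2) with hs
  set s' := √(∑ i, y' i ^ 2) with hs'
  have hs2 : s ^ 2 = ∑ i, y i ^ 2 := Real.sq_sqrt hy0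
  have hs2' : s' ^ 2 = ∑ i, y' i ^ 2 := Real.sq_sqrt hy0'
  have hB : ∑ i, x i * x' i ≤ R ^ 2 := by
    have : ∑ i, x i * x' i ≤ ∑ i, (x i ^ 2 + x' i ^ 2) / 2 :=
      Finset.sum_le_sum fun i _ => by nlinarith [sq_nonneg (x i - x' i)]
    rw [← Finset.sum_div, Finset.sum_add_distrib] at this
    linarith
  have e1 : ∑ k : Fin n × Fin n, (y k.1 * x k.2 - y' k.1 * x' k.2) ^ 2 =
      (∑ i, y i ^ 2) * (∑ i, x i ^ 2) + (∑ i, y' i ^ 2) * (∑ i, x' i ^ 2) -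
        2 * ((∑ i, y i * y' i) * ∑ i, x i * x' i) := by
    rw [Fintype.sum_prod_type, Finset.sum_mul_sum, Finset.sum_mul_sum, Finset.sum_mul_sum]
    simp only [Finset.mul_sum, ← Finset.sum_add_distrib, ← Finset.sum_sub_distrib]
    exact Finset.sum_congr rfl fun i _ => Finset.sum_congr rfl fun j _ => by ring
  have e2 : ∀ (a b : ℝ) (u v : Fin n → ℝ), ∑ k, (a * u k - b * v k) ^ 2 =
      a ^ 2 * ∑ i, u i ^ 2 + b ^ 2 * ∑ i, v i ^ 2 - 2 * a * b * ∑ i, u i * v i := by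
    intro a b u v
    simp only [Finset.mul_sum, ← Finset.sum_add_distrib, ← Finset.sum_sub_distrib]
    exact Finset.sum_congr rfl fun i _ => by ring
  rw [e1, e2, e2, ← hs2, ← hs2']
  set A := ∑ i, y i * y' i
  set B := ∑ i, x i * x' i
  -- Right side minus left side is exactly `R² (s - s')² + 2 (R² - B)(s s' - A)`.
  have h1 : 0 ≤ (R ^ 2 - B) * (s * s' - A) := mul_nonneg (by linarith) (by linarith)
  have h2 : 0 ≤ R ^ 2 * (s - s') ^ 2 := by positivity
  nlinarith

theorem abs_sum_mul_sub_sum_mul_le {x x' y y' : Fin n → ℝ} {δ : ℝ} (hδ : 0 ≤ δ)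
    (hy : ∀ i, |y i| ≤ 1) (hx' : ∀ i, |x' i| ≤ 1) (hxx : ∀ i, |x i - x' i| ≤ δ)
    (hyy : ∀ i, |y i - y' i| ≤ δ) (g : Fin n × Fin n → ℝ) :
    ∑ k : Fin n × Fin n, (y k.1 * x k.2) * g k ≤
      ∑ k : Fin n × Fin n, (y' k.1 * x' k.2) * g k + δ * (2 * ∑ k, |g k|) := by
  rw [Finset.mul_sum, Finset.mul_sum, ← Finset.sum_add_distrib]
  refine Finset.sum_le_sum fun k _ => ?_
  have h : |y k.1 * x k.2 - y' k.1 * x' k.2| ≤ 2 * δ := by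
    have e : y k.1 * x k.2 - y' k.1 * x' k.2 =
        y k.1 * (x k.2 - x' k.2) + (y k.1 - y' k.1) * x' k.2 := by ring
    rw [e]
    refine (abs_add_le _ _).trans ?_
    rw [abs_mul, abs_mul]
    have h1 : |y k.1| * |x k.2 - x' k.2| ≤ 1 * δ :=
      mul_le_mul (hy _) (hxx _) (abs_nonneg _) zero_le_one
    have h2 : |y k.1 - y' k.1| * |x' k.2| ≤ δ * 1 := mul_le_mul (hyy _) (hx' _) (abs_nonneg _) hδ
    linarith
  have h2 : (y k.1 * x k.2 - y' k.1 * x' k.2) * g k ≤ 2 * δ * |g k| := by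
    refine (le_abs_self _).trans ?_
    rw [abs_mul]
    exact mul_le_mul_of_nonneg_right h (abs_nonneg _)
  linarith

variable {p p' q : ℝ≥0∞} [hp : Fact (1 ≤ p)] [hp' : Fact (1 ≤ p')] [hq : Fact (1 ≤ q)]

theorem toReal_inv_add_toReal_inv_of_holderConjugate {p p' : ℝ≥0∞}
    (h : ENNReal.HolderConjugate p p') :
    (p⁻¹).toReal + (p'⁻¹).toReal = 1 := by
  have h1 := ENNReal.HolderConjugate.inv_add_inv_eq_one p p'
  have hle : p⁻¹ ≤ 1 := h1 ▸ le_self_add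
  have hle' : p'⁻¹ ≤ 1 := h1 ▸ le_add_self
  rw [← ENNReal.toReal_add (ne_top_of_le_ne_top ENNReal.one_ne_top hle)
    (ne_top_of_le_ne_top ENNReal.one_ne_top hle'), h1, ENNReal.toReal_one]

/-- **Chevet's inequality** for the `p → q` norm of a standard Gaussian matrix. -/
theorem integral_norm_entriesToCLM_le [NeZero n] (hpp' : ENNReal.HolderConjugate p p') :
    ∫ g, ‖entriesToCLM n p q g‖ ∂(stdGaussianPi (Fin n × Fin n)) ≤
      (n : ℝ) ^ max ((p'⁻¹).toReal - 1 / 2) 0 * expNorm q n +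
        (n : ℝ) ^ max ((q⁻¹).toReal - 1 / 2) 0 * expNorm p' n := by
  set R := (n : ℝ) ^ max ((p'⁻¹).toReal - 1 / 2) 0 with hR
  set S := (n : ℝ) ^ max ((q⁻¹).toReal - 1 / 2) 0 with hS
  have hR0 : 0 ≤ R := by positivity
  have hS0 : 0 ≤ S := by positivity
  have hconj := toReal_inv_add_toReal_inv_of_holderConjugate hpp'
  have hball : ∀ x : Fin n → ℝ, ‖WithLp.toLp p x‖ ≤ 1 → ∑ i, x i ^ 2 ≤ R ^ 2 := by
    intro x hx
    have h := norm_toLp_le_card_rpow_mul (r := 2) (s := p) x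
    rw [Fintype.card_fin, show ((2 : ℝ≥0∞)⁻¹).toReal = 1 / 2 by simp,
      show 1 / 2 - (p⁻¹).toReal = (p'⁻¹).toReal - 1 / 2 by linarith] at h
    rw [sum_sq_eq_norm_toLp_two_sq]
    exact pow_le_pow_left₀ (norm_nonneg _) (h.trans (mul_le_of_le_one_right hR0 hx)) 2
  set K : Set ((Fin n → ℝ) × (Fin n → ℝ)) :=
    {w | ‖WithLp.toLp p w.1‖ ≤ 1 ∧ w.2 ∈ dualBall n q} with hK
  have hKabs : ∀ w ∈ K, (∀ i, |w.1 i| ≤ 1) ∧ ∀ i, |w.2 i| ≤ 1 := fun w hw =>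
    ⟨fun i => (PiLp.norm_apply_le (WithLp.toLp p w.1) i).trans hw.1,
      abs_apply_le_one_of_mem_dualBall hw.2⟩
  have hKtb : TotallyBounded K := by
    refine (isCompact_closedBall (0 : (Fin n → ℝ) × (Fin n → ℝ)) 1).totallyBounded.subset
      fun w hw => ?_
    rw [mem_closedBall_zero_iff, Prod.norm_def]
    exact max_le ((pi_norm_le_iff_of_nonneg zero_le_one).2 (hKabs w hw).1)
      ((pi_norm_le_iff_of_nonneg zero_le_one).2 (hKabs w hw).2)
  have hK0 : (0 : (Fin n → ℝ) × (Fin n → ℝ)) ∈ K := by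
    refine ⟨by simp, fun v => by simp⟩
  have hgi : Integrable (fun g : Fin n × Fin n → ℝ => 2 * ∑ k, |g k|)
      (stdGaussianPi (Fin n × Fin n)) :=
    (integrable_finsetSum _ fun k _ => ((memLp_two_eval k).integrable (by norm_num)).abs).const_mul 2
  have approx : ∀ δ : ℝ, 0 < δ →
      ∫ g, ‖entriesToCLM n p q g‖ ∂(stdGaussianPi (Fin n × Fin n)) ≤
        (R * expNorm q n + S * expNorm p' n) +
          δ * ∫ g, 2 * ∑ k, |g k| ∂(stdGaussianPi (Fin n × Fin n)) := by
    intro δ hδ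
    -- Sudakov–Fernique is available for finite index sets, so `K` is replaced by a finite `δ`-net;
    -- the error is `δ` times an integrable function.
    obtain ⟨t, htK, htf, hcov⟩ := totallyBounded_iff_subset.1 hKtb _ (Metric.dist_mem_uniformity hδ)
    have hnet : ∀ w ∈ K, ∃ v : t, dist w v.1 < δ := fun w hw => by
      obtain ⟨v, hv, hd⟩ := Set.mem_iUnion₂.1 (hcov hw)
      exact ⟨⟨v, hv⟩, hd⟩
    have : Fintype t := htf.fintype
    have : Nonempty t := (hnet 0 hK0).nonempty
    have pointwise : ∀ g : Fin n × Fin n → ℝ, ‖entriesToCLM n p q g‖ ≤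
        (⨆ w : t, ∑ k : Fin n × Fin n, (w.1.2 k.1 * w.1.1 k.2) * g k) + δ * (2 * ∑ k, |g k|) := by
      intro g
      rw [← matrixOpNorm_eq_norm]
      have : Nonempty {x : PiLp p (fun _ : Fin n => ℝ) // ‖x‖ = 1} :=
        ⟨⟨WithLp.toLp p (Pi.single 0 1), by rw [PiLp.toLp_single, PiLp.norm_single]; simp⟩⟩
      refine ciSup_le fun x => ?_
      obtain ⟨y, hy, hyx⟩ := exists_mem_dualBall (q := q)
        ((Matrix.of fun i j => g (i, j)) *ᵥ WithLp.ofLp x.1)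
      rw [← hyx, sum_mul_mulVec_eq]
      have hw : (WithLp.ofLp x.1, y) ∈ K := ⟨x.2.le, hy⟩
      obtain ⟨v, hv⟩ := hnet _ hw
      rw [dist_eq_norm, Prod.norm_def, max_lt_iff] at hv
      refine (abs_sum_mul_sub_sum_mul_le hδ.le (hKabs _ hw).2 (hKabs _ (htK v.2)).1
        (fun i => (norm_le_pi_norm _ i).trans hv.1.le)
        (fun i => (norm_le_pi_norm _ i).trans hv.2.le) g).trans (add_le_add_left ?_ _)
      exact le_ciSup (f := fun w : t => ∑ k : Fin n × Fin n, (w.1.2 k.1 * w.1.1 k.2) * g k)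
        (Set.finite_range _).bddAbove v
    have sup_int : ∀ {κ : Type} [Fintype κ] (a : t → κ → ℝ),
        Integrable (fun g => ⨆ w, ∑ k, a w k * g k) (stdGaussianPi κ) := fun a =>
      (integrable_iSup_of_isGaussian (μ := (stdGaussianPi _).map (rowsCLM a))).comp_measurable
        (by fun_prop)
    -- Coefficients of the decoupled process `R⟨g, y⟩ + ‖y‖₂⟨h, x⟩`, with `g` and `h` independent.
    set b : t → Fin n ⊕ Fin n → ℝ := fun w =>
      Sum.elim (fun k => R * w.1.2 k) (fun k => √(∑ i, w.1.2 i ^ 2) * w.1.1 k) with hb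
    have compare := integral_iSup_linear_le
      (fun (w : t) (k : Fin n × Fin n) => w.1.2 k.1 * w.1.1 k.2) b fun w w' => by
        rw [Fintype.sum_sum_type]
        exact sum_sq_sub_tensor_le _ _ (hball _ (htK w.2).1) (hball _ (htK w'.2).1)
    have j1 : Integrable (fun g : Fin n ⊕ Fin n → ℝ => ‖WithLp.toLp q fun k => g (Sum.inl k)‖)
        (stdGaussianPi (Fin n ⊕ Fin n)) :=
      (measurePreserving_stdGaussianPi_inl (κ := Fin n) (κ' := Fin n)).integrable_comp_of_integrable (integrable_norm_toLp q)
    have j2 : Integrable (fun g : Fin n ⊕ Fin n → ℝ => ‖WithLp.toLp p' fun k => g (Sum.inr k)‖)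
        (stdGaussianPi (Fin n ⊕ Fin n)) :=
      (measurePreserving_stdGaussianPi_inr (κ := Fin n) (κ' := Fin n)).integrable_comp_of_integrable (integrable_norm_toLp p')
    have upper : ∫ g, ⨆ w, ∑ k, b w k * g k ∂(stdGaussianPi (Fin n ⊕ Fin n)) ≤
        R * expNorm q n + S * expNorm p' n := by
      calc _ ≤ ∫ g : Fin n ⊕ Fin n → ℝ, (R * ‖WithLp.toLp q fun k => g (Sum.inl k)‖ +
              S * ‖WithLp.toLp p' fun k => g (Sum.inr k)‖) ∂(stdGaussianPi (Fin n ⊕ Fin n)) := by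
            refine integral_mono (sup_int b) ((j1.const_mul R).add (j2.const_mul S)) fun g => ?_
            refine ciSup_le fun w => ?_
            rw [Fintype.sum_sum_type]
            simp only [hb, Sum.elim_inl, Sum.elim_inr, mul_assoc, ← Finset.mul_sum]
            refine add_le_add (mul_le_mul_of_nonneg_left ((htK w.2).2 _) hR0) ?_
            refine (mul_le_mul_of_nonneg_left ((sum_mul_le_norm_toLp_mul_norm_toLp hpp' _ _).trans
              (mul_le_of_le_one_left (norm_nonneg _) (htK w.2).1)) (Real.sqrt_nonneg _)).trans ?_
            refine mul_le_mul_of_nonneg_right ?_ (norm_nonneg _)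
            rw [sqrt_sum_sq_eq_norm_toLp_two]
            exact norm_toLp_two_le_of_mem_dualBall (htK w.2).2
        _ = _ := by
            rw [integral_add (j1.const_mul R) (j2.const_mul S), integral_const_mul,
              integral_const_mul]
            congr 2
            · rw [expNorm, ← (measurePreserving_stdGaussianPi_inl (κ := Fin n) (κ' := Fin n)).map_eq,
                integral_map measurePreserving_stdGaussianPi_inl.measurable.aemeasurable
                   (continuous_norm_toLp q).aestronglyMeasurable]
            · rw [expNorm, ← (measurePreserving_stdGaussianPi_inr (κ := Fin n) (κ' := Fin n)).map_eq,
                integral_map measurePreserving_stdGaussianPi_inr.measurable.aemeasurable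
                   (continuous_norm_toLp p').aestronglyMeasurable]
    calc _ ≤ ∫ g : Fin n × Fin n → ℝ,
            ((⨆ w : t, ∑ k : Fin n × Fin n, (w.1.2 k.1 * w.1.1 k.2) * g k) +
              δ * (2 * ∑ k, |g k|)) ∂(stdGaussianPi (Fin n × Fin n)) :=
          integral_mono integrable_norm_entriesToCLM
            ((sup_int _).add (hgi.const_mul δ)) pointwise
      _ ≤ _ := by
          rw [integral_add (sup_int _) (hgi.const_mul δ), integral_const_mul]
          exact add_le_add_left (compare.trans upper) _
  have lim : Tendsto (fun δ : ℝ => (R * expNorm q n + S * expNorm p' n) +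
      δ * ∫ g, 2 * ∑ k, |g k| ∂(stdGaussianPi (Fin n × Fin n))) (𝓝[>] 0)
      (𝓝 ((R * expNorm q n + S * expNorm p' n) +
        0 * ∫ g, 2 * ∑ k, |g k| ∂(stdGaussianPi (Fin n × Fin n)))) :=
    (((tendsto_id (α := ℝ)).mono_left nhdsWithin_le_nhds).mul_const _).const_add _
  have := ge_of_tendsto lim (eventually_mem_nhdsWithin.mono approx)
  simpa using this

end Chevet

/-! ### Matching lower bounds -/

section LowerBound
variable {n : ℕ} {p p' q : ℝ≥0∞} [hp : Fact (1 ≤ p)] [hq : Fact (1 ≤ q)]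

/-- Orthogonal rows of length `R` give a vector with the law of `R` times a standard Gaussian one.
-/
theorem integral_norm_rowsCLM_eq {κ : Type*} [Fintype κ] (r : ℝ≥0∞) [Fact (1 ≤ r)]
    {R : ℝ} (hR : 0 ≤ R) (c : Fin n → κ → ℝ)
    (hc : ∀ i j, ∑ k, c i k * c j k = if i = j then R ^ 2 else 0) :
    ∫ g, ‖WithLp.toLp r (rowsCLM c g)‖ ∂(stdGaussianPi κ) = R * expNorm r n := by
  have hlaw := map_rowsCLM_eq c (fun i k : Fin n => if i = k then R else 0) fun i j => by
    rw [hc]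
    simp only [ite_mul, zero_mul, Finset.sum_ite_eq, Finset.mem_univ, if_true, mul_ite, mul_zero]
    simp only [sq]
  have hcont := continuous_norm_toLp (κ := Fin n) r
  rw [← integral_map (μ := stdGaussianPi κ) (φ := rowsCLM c) (by fun_prop)
    hcont.aestronglyMeasurable, hlaw, integral_map (by fun_prop) hcont.aestronglyMeasurable,
    expNorm, ← integral_const_mul]
  congr 1
  ext g
  have : rowsCLM (fun i k : Fin n => if i = k then R else 0) g = R • g := by
    ext i; simp [rowsCLM_apply]
  rw [this, WithLp.toLp_smul, norm_smul, Real.norm_of_nonneg hR]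

/-- The extremal vectors are a basis vector for `r ≤ 2` and the constant vector `n^{-1/r}` for `r ≥
2`. -/
theorem exists_norm_toLp_le_one_sum_sq_eq [NeZero n] (r : ℝ≥0∞) [Fact (1 ≤ r)] :
    ∃ x : Fin n → ℝ, ‖WithLp.toLp r x‖ ≤ 1 ∧
      ∑ i, x i ^ 2 = ((n : ℝ) ^ max (1 / 2 - (r⁻¹).toReal) 0) ^ 2 := by
  have hn : (0 : ℝ) < n := by exact_mod_cast NeZero.pos n
  rcases le_total (1 / 2 - (r⁻¹).toReal) 0 with h | h
  · refine ⟨Pi.single 0 1, ?_, ?_⟩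
    · rw [PiLp.toLp_single, PiLp.norm_single]; simp
    · rw [max_eq_right h]
      simp [Pi.single_apply]
  · refine ⟨Function.const _ ((n : ℝ) ^ (-(r⁻¹).toReal)), ?_, ?_⟩
    · rw [PiLp.norm_toLp_const', one_div, Real.norm_of_nonneg (by positivity)]
      push_cast
      rw [Fintype.card_fin, ← Real.rpow_add hn]
      simp
    · rw [max_eq_left h]
      simp only [Function.const_apply, Finset.sum_const, Finset.card_univ, Fintype.card_fin,
        nsmul_eq_mul]
      rw [← Real.rpow_natCast, ← Real.rpow_natCast, ← Real.rpow_mul hn.le, ← Real.rpow_mul hn.le]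
      nth_rewrite 1 [← Real.rpow_one (n : ℝ)]
      rw [← Real.rpow_add hn]
      congr 1
      push_cast
      ring

theorem le_integral_norm_entriesToCLM_left [NeZero n] (hpp' : ENNReal.HolderConjugate p p') :
    (n : ℝ) ^ max ((p'⁻¹).toReal - 1 / 2) 0 * expNorm q n ≤
      ∫ g, ‖entriesToCLM n p q g‖ ∂(stdGaussianPi (Fin n × Fin n)) := by
  have hconj := toReal_inv_add_toReal_inv_of_holderConjugate hpp'
  obtain ⟨x, hx1, hx2⟩ := exists_norm_toLp_le_one_sum_sq_eq (n := n) p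
  rw [show 1 / 2 - (p⁻¹).toReal = (p'⁻¹).toReal - 1 / 2 by linarith] at hx2
  rw [← integral_norm_rowsCLM_eq q (by positivity)
    (fun i (k : Fin n × Fin n) => if i = k.1 then x k.2 else 0) fun i j => by
      rw [← hx2, Fintype.sum_prod_type]
      simp only [ite_mul, zero_mul, mul_ite, mul_zero, Finset.sum_const_zero,
        Finset.sum_ite_irrel, Finset.sum_ite_eq, Finset.mem_univ, if_true]
      simp only [sq]]
  have hle : ∀ g : Fin n × Fin n → ℝ, ‖WithLp.toLp q
      (rowsCLM (fun i (k : Fin n × Fin n) => if i = k.1 then x k.2 else 0) g)‖ ≤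
      ‖entriesToCLM n p q g‖ := fun g => by
    have e : rowsCLM (fun i (k : Fin n × Fin n) => if i = k.1 then x k.2 else 0) g =
        (Matrix.of fun i j => g (i, j)) *ᵥ x := by
      ext i
      rw [rowsCLM_apply, Fintype.sum_prod_type]
      simp [Matrix.mulVec, dotProduct, Finset.sum_ite_irrel, mul_comm]
    rw [e, ← entriesToCLM_apply (p := p)]
    exact ((entriesToCLM n p q g).le_opNorm _).trans (mul_le_of_le_one_right (norm_nonneg _) hx1)
  have hcont := continuous_norm_toLp (κ := Fin n) q
  exact integral_mono (Integrable.mono' integrable_norm_entriesToCLM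
    (hcont.comp (ContinuousLinearMap.continuous _)).aestronglyMeasurable
    (.of_forall fun g => by rw [norm_norm]; exact hle g)) integrable_norm_entriesToCLM hle

theorem le_integral_norm_entriesToCLM_right [NeZero n] [hp' : Fact (1 ≤ p')]
    (hpp' : ENNReal.HolderConjugate p p')
    (hp'top : p' ≠ ∞) :
    (n : ℝ) ^ max ((q⁻¹).toReal - 1 / 2) 0 * expNorm p' n ≤
      ∫ g, ‖entriesToCLM n p q g‖ ∂(stdGaussianPi (Fin n × Fin n)) := by
  have hq1 : q⁻¹ ≤ 1 := ENNReal.inv_le_one.2 hq.out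
  -- The conjugate exponent of `q`; for `q = 1` the convention `0⁻¹ = ∞` gives the right value.
  have hq'q : ENNReal.HolderConjugate (1 - q⁻¹)⁻¹ q := by
    rw [ENNReal.holderConjugate_iff, inv_inv, tsub_add_cancel_of_le hq1]
  have hq' : Fact (1 ≤ (1 - q⁻¹)⁻¹) := ⟨by rw [ENNReal.one_le_inv]; exact tsub_le_self⟩
  have hconj := toReal_inv_add_toReal_inv_of_holderConjugate hq'q
  obtain ⟨y, hy1, hy2⟩ := exists_norm_toLp_le_one_sum_sq_eq (n := n) (1 - q⁻¹)⁻¹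
  have hyD : y ∈ dualBall n q := mem_dualBall_of_norm_le_one hq'q hy1
  rw [show 1 / 2 - ((1 - q⁻¹)⁻¹⁻¹).toReal = (q⁻¹).toReal - 1 / 2 by linarith] at hy2
  rw [← integral_norm_rowsCLM_eq p' (by positivity)
    (fun j (k : Fin n × Fin n) => if j = k.2 then y k.1 else 0) fun i j => by
      rw [← hy2, Fintype.sum_prod_type_right]
      simp only [ite_mul, zero_mul, mul_ite, mul_zero, Finset.sum_const_zero,
        Finset.sum_ite_irrel, Finset.sum_ite_eq, Finset.mem_univ, if_true]
      simp only [sq]]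
  have hle : ∀ g : Fin n × Fin n → ℝ, ‖WithLp.toLp p'
      (rowsCLM (fun j (k : Fin n × Fin n) => if j = k.2 then y k.1 else 0) g)‖ ≤
      ‖entriesToCLM n p q g‖ := fun g => by
    -- The matrix applied here is `Gᵀy`; choosing `x` to norm it gives `⟨y, Gx⟩ = ‖Gᵀy‖_{p'}`.
    obtain ⟨x, hx1, hx2⟩ := exists_norming_toLp hpp' hp'top
      (rowsCLM (fun j (k : Fin n × Fin n) => if j = k.2 then y k.1 else 0) g)
    rw [← hx2]
    refine le_trans (le_of_eq ?_) (sum_mul_mulVec_le_norm g hx1 hyD)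
    rw [sum_mul_mulVec_eq, Fintype.sum_prod_type_right]
    refine Finset.sum_congr rfl fun j _ => ?_
    rw [rowsCLM_apply, Fintype.sum_prod_type_right]
    simp only [ite_mul, zero_mul, Finset.sum_const_zero,
        Finset.sum_ite_irrel, Finset.sum_ite_eq, Finset.mem_univ, if_true, Finset.mul_sum]
    exact Finset.sum_congr rfl fun i _ => by ring
  have hcont := continuous_norm_toLp (κ := Fin n) p'
  exact integral_mono (Integrable.mono' integrable_norm_entriesToCLM
    (hcont.comp (ContinuousLinearMap.continuous _)).aestronglyMeasurable
    (.of_forall fun g => by rw [norm_norm]; exact hle g)) integrable_norm_entriesToCLM hle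

end LowerBound

/-! ### Transfer to the random matrix and passage to the limit -/

section Limits

theorem IsStdGaussianMatrix.hasLaw_entries {n : ℕ} {Ω : Type*} [MeasurableSpace Ω]
    {G : Ω → Matrix (Fin n) (Fin n) ℝ} {P : Measure Ω} (h : IsStdGaussianMatrix G P) :
    HasLaw (fun ω (k : Fin n × Fin n) => G ω k.1 k.2) (stdGaussianPi (Fin n × Fin n)) P :=
  iIndepFun.hasLaw_pi (fun k => h.hasLaw k.1 k.2) h.indep

theorem IsStdGaussianMatrix.integrable_matrixOpNorm {n : ℕ} {Ω : Type*} [MeasurableSpace Ω]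
    {G : Ω → Matrix (Fin n) (Fin n) ℝ} {P : Measure Ω} (h : IsStdGaussianMatrix G P)
    (p q : ℝ≥0∞) [Fact (1 ≤ p)] [Fact (1 ≤ q)] :
    Integrable (fun ω => matrixOpNorm p q (G ω)) P := by
  have e : (fun ω => matrixOpNorm p q (G ω)) = (fun g => ‖entriesToCLM n p q g‖) ∘
      fun ω (k : Fin n × Fin n) => G ω k.1 k.2 := by
    ext ω; exact matrixOpNorm_eq_norm fun k => G ω k.1 k.2
  have hl := h.hasLaw_entries
  have hi := integrable_norm_entriesToCLM (n := n) (p := p) (q := q)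
  rw [← hl.map_eq] at hi
  rw [e]
  exact hi.comp_aemeasurable hl.aemeasurable

theorem IsStdGaussianMatrix.integral_matrixOpNorm {n : ℕ} {Ω : Type*} [MeasurableSpace Ω]
    {G : Ω → Matrix (Fin n) (Fin n) ℝ} {P : Measure Ω} (h : IsStdGaussianMatrix G P)
    (p q : ℝ≥0∞) [Fact (1 ≤ p)] [Fact (1 ≤ q)] :
    ∫ ω, matrixOpNorm p q (G ω) ∂P =
      ∫ g, ‖entriesToCLM n p q g‖ ∂(stdGaussianPi (Fin n × Fin n)) := by
  rw [← h.hasLaw_entries.integral_comp continuous_norm_entriesToCLM.aestronglyMeasurable]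
  congr 1
  ext ω
  exact matrixOpNorm_eq_norm fun k => G ω k.1 k.2

/-- If `E n` is squeezed between `n ^ α E‖g‖_r` and `n ^ α E‖g‖_r + n ^ β E‖g‖_s`, and the
second summand is of lower order, then `E n` is asymptotic to `n ^ (α + 1 / r) ξ_r`. -/
theorem tendsto_of_expNorm_bounds {r s : ℝ≥0∞} [Fact (1 ≤ r)] [Fact (1 ≤ s)] (hr : r ≠ ∞)
    {α β e : ℝ} (he : α + (r⁻¹).toReal = e) (hlt : β + (s⁻¹).toReal < e) {E : ℕ → ℝ}
    (hlo : ∀ n : ℕ, 0 < n → (n : ℝ) ^ α * expNorm r n ≤ E n)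
    (hhi : ∀ n : ℕ, 0 < n → E n ≤ (n : ℝ) ^ α * expNorm r n + (n : ℝ) ^ β * expNorm s n) :
    Tendsto (fun n : ℕ => (n : ℝ) ^ (-e) * E n) atTop (𝓝 (gaussianXi r)) := by
  subst he
  have h1 := tendsto_rpow_neg_mul_expNorm hr
  have h2 := tendsto_rpow_neg_mul_expNorm_zero (r := s) (e := α + (r⁻¹).toReal - β) (by linarith)
  have h3 := h1.add h2
  rw [add_zero] at h3
  refine tendsto_of_tendsto_of_tendsto_of_le_of_le' h1 h3 ?_ ?_
  all_goals
    filter_upwards [eventually_gt_atTop 0] with n hn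
    have hn' : (0 : ℝ) < n := by exact_mod_cast hn
    have hpos : 0 ≤ (n : ℝ) ^ (-(α + (r⁻¹).toReal)) := by positivity
    have e1 : (n : ℝ) ^ (-(α + (r⁻¹).toReal)) * (n : ℝ) ^ α = (n : ℝ) ^ (-(r⁻¹).toReal) := by
      rw [← Real.rpow_add hn']; congr 1; ring
    have e2 : (n : ℝ) ^ (-(α + (r⁻¹).toReal)) * (n : ℝ) ^ β =
        (n : ℝ) ^ (-(α + (r⁻¹).toReal - β)) := by
      rw [← Real.rpow_add hn']; congr 1; ring
  · rw [← e1, mul_assoc]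
    exact mul_le_mul_of_nonneg_left (hlo n hn) hpos
  · rw [← e1, ← e2, mul_assoc, mul_assoc, ← mul_add]
    exact mul_le_mul_of_nonneg_left (hhi n hn) hpos

end Limits

theorem proposition3p3 {Ω : ℕ → Type*} [∀ n, MeasurableSpace (Ω n)]
    (P : ∀ n, Measure (Ω n)) [∀ n, IsProbabilityMeasure (P n)]
    (G : ∀ n, Ω n → Matrix (Fin n) (Fin n) ℝ)
    (hG : ∀ n, IsStdGaussianMatrix (G n) (P n))
    (p p' q : ℝ≥0∞) (hp : 1 ≤ p) (hpp' : ENNReal.HolderConjugate p p') (hq : 1 ≤ q) :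
    (∀ n, Integrable (fun ω => matrixOpNorm p q (G n ω)) (P n)) ∧
    (p = 1 → q < ∞ →
      Tendsto (fun n : ℕ => (n : ℝ) ^ (-(q⁻¹).toReal) * ∫ ω, matrixOpNorm p q (G n ω) ∂(P n))
        atTop (𝓝 (gaussianXi q))) ∧
    (1 < p → q = ∞ →
      Tendsto (fun n : ℕ => (n : ℝ) ^ (-(p'⁻¹).toReal) * ∫ ω, matrixOpNorm p q (G n ω) ∂(P n))
        atTop (𝓝 (gaussianXi p'))) ∧
    (1 < p → q < ∞ → chevetExponent q p' ≠ chevetExponent p' q →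
      Tendsto (fun n : ℕ =>
          (n : ℝ) ^ (-max (chevetExponent q p') (chevetExponent p' q)) *
            ∫ ω, matrixOpNorm p q (G n ω) ∂(P n))
        atTop (𝓝 (if chevetExponent q p' > chevetExponent p' q
          then gaussianXi p' else gaussianXi q))) := by
  have fp : Fact (1 ≤ p) := ⟨hp⟩
  have fq : Fact (1 ≤ q) := ⟨hq⟩
  have hinv := ENNReal.HolderConjugate.inv_add_inv_eq_one p p'
  have hp'1 : 1 ≤ p' := ENNReal.inv_le_one.1 (hinv ▸ le_add_self)
  have fp' : Fact (1 ≤ p') := ⟨hp'1⟩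
  have hp'0 : 0 ≤ (p'⁻¹).toReal := ENNReal.toReal_nonneg
  have hp'le : (p'⁻¹).toReal ≤ 1 := by
    simpa using ENNReal.toReal_mono ENNReal.one_ne_top (ENNReal.inv_le_one.2 hp'1)
  have hp'top : 1 < p → p' ≠ ∞ := by
    rintro h rfl
    rw [ENNReal.inv_top, add_zero, ENNReal.inv_eq_one] at hinv
    exact h.ne' hinv
  have hinvpos : ∀ r : ℝ≥0∞, 1 ≤ r → r ≠ ∞ → 0 < (r⁻¹).toReal := fun r h1 hr =>
    ENNReal.toReal_pos (ENNReal.inv_ne_zero.2 hr)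
      (ENNReal.inv_ne_top.2 (zero_lt_one.trans_le h1).ne')
  have hE : ∀ n, ∫ ω, matrixOpNorm p q (G n ω) ∂(P n) =
      ∫ g, ‖entriesToCLM n p q g‖ ∂(stdGaussianPi (Fin n × Fin n)) := fun n =>
    (hG n).integral_matrixOpNorm p q
  have hhi : ∀ n : ℕ, 0 < n → ∫ ω, matrixOpNorm p q (G n ω) ∂(P n) ≤
      (n : ℝ) ^ max ((p'⁻¹).toReal - 1 / 2) 0 * expNorm q n +
        (n : ℝ) ^ max ((q⁻¹).toReal - 1 / 2) 0 * expNorm p' n := fun n hn => by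
    have : NeZero n := ⟨hn.ne'⟩
    rw [hE]
    exact integral_norm_entriesToCLM_le hpp'
  have hlo : ∀ n : ℕ, 0 < n → (n : ℝ) ^ max ((p'⁻¹).toReal - 1 / 2) 0 * expNorm q n ≤
      ∫ ω, matrixOpNorm p q (G n ω) ∂(P n) := fun n hn => by
    have : NeZero n := ⟨hn.ne'⟩
    rw [hE]
    exact le_integral_norm_entriesToCLM_left hpp'
  have hlo' : p' ≠ ∞ → ∀ n : ℕ, 0 < n →
      (n : ℝ) ^ max ((q⁻¹).toReal - 1 / 2) 0 * expNorm p' n ≤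
        ∫ ω, matrixOpNorm p q (G n ω) ∂(P n) := fun h n hn => by
    have : NeZero n := ⟨hn.ne'⟩
    rw [hE]
    exact le_integral_norm_entriesToCLM_right hpp' h
  have hhi' : ∀ n : ℕ, 0 < n → ∫ ω, matrixOpNorm p q (G n ω) ∂(P n) ≤
      (n : ℝ) ^ max ((q⁻¹).toReal - 1 / 2) 0 * expNorm p' n +
        (n : ℝ) ^ max ((p'⁻¹).toReal - 1 / 2) 0 * expNorm q n := fun n hn =>
    (hhi n hn).trans_eq (add_comm _ _)
  refine ⟨fun n => (hG n).integrable_matrixOpNorm p q, fun hp1 hqt => ?_, fun hp1 hqt => ?_,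
    fun hp1 hqt hne => ?_⟩
  · have hqpos := hinvpos q hq hqt.ne
    have hp'inv : (p'⁻¹).toReal = 0 := by
      have := toReal_inv_add_toReal_inv_of_holderConjugate hpp'
      rw [hp1] at this
      simpa using this
    refine tendsto_of_expNorm_bounds hqt.ne ?_ ?_ hlo hhi
    · rw [hp'inv, max_eq_right (by norm_num), zero_add]
    -- Here `p' = ∞`, so the second Chevet term has exponent `(1/q - 1/2)₊`, strictly below `1/q`.
    -- The case `q = ∞` is symmetric.
    · rw [hp'inv, add_zero]
      exact max_lt (by linarith) hqpos
  · have hpos := hinvpos p' hp'1 (hp'top hp1)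
    have hqinv : (q⁻¹).toReal = 0 := by simp [hqt]
    refine tendsto_of_expNorm_bounds (hp'top hp1) ?_ ?_ (hlo' (hp'top hp1)) hhi'
    · rw [hqinv, max_eq_right (by norm_num), zero_add]
    · rw [hqinv, add_zero]
      exact max_lt (by linarith) hpos
  -- The two values of `chevetExponent` are by definition the growth exponents of the two Chevet
  -- terms, so the strict inequality `h` says which one is negligible.
  · rcases lt_or_gt_of_ne hne with h | h
    · rw [if_neg (not_lt.2 h.le), max_eq_right h.le]
      exact tendsto_of_expNorm_bounds hqt.ne rfl h hlo hhi
    · rw [if_pos h, max_eq_left h.le]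
      exact tendsto_of_expNorm_bounds (hp'top hp1) rfl h (hlo' (hp'top hp1)) hhi'
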